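/- **Theorem (Impossibility of swapping).** All Hilbert spaces are finite-dimensional, a *quantum operation* is a completely positive trace-preserving map, $M\cdot\rho:=M\rho M^\dagger$, and $\Delta(\rho,\sigma)=\tfrac12\|\rho-\sigma\|_1$ is the trace distance. *Protocols.* Let $\mathcal A_0,\mathcal B_0$ be input spaces and $\mathcal R$ a reference system with $\dim\mathcal R=\dim\mathcal A_0\dim\mathcal B_0$. An *$n$-step two-party strategy* consists of memory spaces $\mathcal A_i=\mathcal A_i^{O}\otimes\mathcal A_i'$ and $\mathcal B_i=\mathcal B_i^{O}\otimes\mathcal B_i'$ ($1\le i\le n$), quantum operations $\mathscr A_i:L(\mathcal A_{i-1})\to L(\mathcal A_i)$ and $\mathscr B_i:L(\mathcal B_{i-1})\to L(\mathcal B_i)$ of Alice and Bob, and oracles, i.e. quantum operations $O_i$ on $L(\mathcal A_i^{O}\otimes\mathcal B_i^{O})$. On input a state $\rho$ of $\mathcal A_0\otimes\mathcal B_0\otimes\mathcal R$, the state $\rho_i(\rho)$ after step $i$ arises from $\rho_{i-1}(\rho)$ (with $\rho_0(\rho)=\rho$) by applying $\mathscr A_i\otimes\mathscr B_i$ and then $O_i$.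 The strategy is a *protocol* if $\mathcal A_n\approx\mathcal A_0$ and $\mathcal B_n\approx\mathcal B_0$ (equal dimensions, with fixed identifications of the computational bases). It is in the *bare model* if every $O_i$ is a communication oracle, in one of the two directions: the sender's and the receiver's oracle registers have equal dimension, the content of the sender's register is moved to the receiver's register (whose previous content is discarded), and the sender's register is reset to a fixed basis state. The protocol is *$\varepsilon$-correct* for a unitary $U$ on $\mathcal A_0\otimes\mathcal B_0$ if $\Delta(\rho_n(\rho),(U\otimes 1_{\mathcal R})\cdot\rho)\le\varepsilon$ for all input states $\rho$. *Privacy.* An adversary $\tilde{\mathscr A}$ replaces Alice's spaces $\mathcal A_i$ and operations by arbitrary $\tilde{\mathcal A}_i=\mathcal A_i^{O}\otimes\tilde{\mathcal A}_i'$ and arbitrary quantum operations, with the same input space, oracle registers, oracles and honest Bob; let $\tilde\rho_i(\rho)$ be the resulting states. It is *$\varepsilon$-specious* if there are quantum operations $T_i:L(\tilde{\mathcal A}_i)\to L(\mathcal A_i)$ with $\Delta((T_i\otimes\mathrm{id})(\tilde\rho_i(\rho)),\rho_i(\rho))\le\varepsilon$ for all input states $\rho$ and all $1\le i\le n$. The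 protocol is *$\delta$-private against $\varepsilon$-specious Alice* if for each such $\tilde{\mathscr A}$ there are quantum operations $S_i:L(\mathcal A_0)\to L(\tilde{\mathcal A}_i)$ and bits $q_i\in\{0,1\}$ ($1\le i\le n$) such that $$\Delta\Bigl(\operatorname{tr}_{\mathcal B_0}\bigl[(S_i\otimes\mathrm{id})((U^{q_i}\otimes 1_{\mathcal R})\cdot\rho)\bigr],\ \operatorname{tr}_{\mathcal B_i}\bigl[\tilde\rho_i(\rho)\bigr]\Bigr)\le\delta$$ for all input states $\rho$ and all $1\le i\le n$. Privacy against Bob is defined symmetrically, and *$\delta$-private against $\varepsilon$-specious adversaries* means both. A family $(\Pi_m)$ of protocols, $m\ge1$ being the security parameter, is *statistically private* against $\varepsilon(m)$-specious adversaries if for some $\gamma>0$ every $\Pi_m$ is $2^{-\gamma m}$-private against $\varepsilon(m)$-specious adversaries. Let $\mathsf{SWAP}:|a\rangle|b\rangle\mapsto|b\rangle|a\rangle$ be the swap gate on $\mathcal A_0\otimes\mathcal B_0=\mathbb C^2\otimes\mathbb C^2$. Then: 1. There is an absolute constant $\varepsilon_0>0$ such that, for every number of steps $n$ and every $\varepsilon\ge0$,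 no $n$-step protocol for $\mathsf{SWAP}$ in the bare model is both $\varepsilon_0$-correct and $\varepsilon_0$-private against $\varepsilon$-specious adversaries. 2. Consequently there is no correct and statistically private two-party protocol for $\mathsf{SWAP}$ in the bare model: for any step numbers $n(m)$ and any $\varepsilon(m)\ge0$ (for example negligible, or $0$), no family $(\Pi_m)$ of $n(m)$-step protocols in the bare model is both correct for $\mathsf{SWAP}$ (that is, $\mu(m)$-correct for some $\mu(m)\to0$; in particular this covers $\mu=0$) and statistically private for $\mathsf{SWAP}$ against $\varepsilon(m)$-specious adversaries. -/

import Mathlib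

open scoped ComplexOrder MatrixOrder Kronecker

noncomputable section

namespace TwoParty

/-! ### States, trace distance, quantum operations

A register is a Hilbert space `ℂ^X` with a finite computational basis `X`;
operators on it are matrices indexed by `X`, and the tensor product of two registers
is indexed by the product of the two index types. -/

/-- The linear operators on the register with computational basis `X`. -/
abbrev Op (X : Type) : Type := Matrix X X ℂ

/-- Super-operators from the register `X` to the register `Y`. -/
abbrev SuperOp (X Y : Type) : Type := Op X →ₗ[ℂ] Op Y

/-- Density operators. -/
def IsState {X : Type} [Fintype X] (ρ : Op X) : Prop :=
  ρ.PosSemidef ∧ ρ.trace = 1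

/-- Trace norm `tr |M|`, where `|M| = √(M† M)`. -/
def traceNorm {X : Type} [Fintype X] [DecidableEq X] (M : Op X) : ℝ :=
  (CFC.abs M).trace.re

/-- Trace norm distance `Δ(ρ, σ) = ½ ‖ρ - σ‖`. -/
def traceDist {X : Type} [Fintype X] [DecidableEq X] (ρ σ : Op X) : ℝ :=
  traceNorm (ρ - σ) / 2

/-- `Φ ⊗ id_Z`, acting on the operators on `X ⊗ Z`. -/
def tensorId {X Y : Type} (Z : Type) (Φ : SuperOp X Y) (M : Op (X × Z)) : Op (Y × Z) :=
  Matrix.of fun p p' => Φ (Matrix.of fun x x' => M (x, p.2) (x', p'.2)) p.1 p'.1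

/-- Quantum operations: completely positive and trace preserving super-operators. -/
def IsQuantumOp {X Y : Type} [Fintype X] [Fintype Y] (Φ : SuperOp X Y) : Prop :=
  (∀ (k : ℕ) (M : Op (X × Fin k)), M.PosSemidef → (tensorId (Fin k) Φ M).PosSemidef) ∧
    ∀ M : Op X, (Φ M).trace = M.trace

/-! ### Operators on `A ⊗ B ⊗ R`  -/

/-- `(Φ ⊗ id_{B ⊗ R}) (M)`. -/
def applyA {A A' B R : Type} (Φ : SuperOp A A') (M : Op ((A × B) × R)) : Op ((A' × B) × R) :=
  Matrix.of fun p p' =>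
    Φ (Matrix.of fun x x' => M ((x, p.1.2), p.2) ((x', p'.1.2), p'.2)) p.1.1 p'.1.1

/-- `(id_A ⊗ Φ ⊗ id_R) (M)`. -/
def applyB {A B B' R : Type} (Φ : SuperOp B B') (M : Op ((A × B) × R)) : Op ((A × B') × R) :=
  Matrix.of fun p p' =>
    Φ (Matrix.of fun y y' => M ((p.1.1, y), p.2) ((p'.1.1, y'), p'.2)) p.1.2 p'.1.2

/-- The oracle `O`, acting on the oracle registers `AO ⊗ BO`, applied to an operator on
`(AO ⊗ A') ⊗ (BO ⊗ B') ⊗ R`. -/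
def applyOracle {AO A' BO B' R : Type} (O : SuperOp (AO × BO) (AO × BO))
    (M : Op (((AO × A') × (BO × B')) × R)) : Op (((AO × A') × (BO × B')) × R) :=
  Matrix.of fun p p' =>
    O (Matrix.of fun u u' =>
        M (((u.1, p.1.1.2), (u.2, p.1.2.2)), p.2) (((u'.1, p'.1.1.2), (u'.2, p'.1.2.2)), p'.2))
      (p.1.1.1, p.1.2.1) (p'.1.1.1, p'.1.2.1)

/-- Partial trace over Alice's register. -/
def traceOutA {A B R : Type} [Fintype A] (M : Op ((A × B) × R)) : Op (B × R) :=
  Matrix.of fun p p' => ∑ a, M ((a, p.1), p.2) ((a, p'.1), p'.2)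

/-- Partial trace over Bob's register. -/
def traceOutB {A B R : Type} [Fintype B] (M : Op ((A × B) × R)) : Op (A × R) :=
  Matrix.of fun p p' => ∑ b, M ((p.1, b), p.2) ((p'.1, b), p'.2)

/-- `(U ⊗ 𝟙_R) · ρ = (U ⊗ 𝟙_R) ρ (U ⊗ 𝟙_R)†`. -/
def applyU {X R : Type} [Fintype X] [Fintype R] [DecidableEq R]
    (U : Matrix X X ℂ) (ρ : Op (X × R)) : Op (X × R) :=
  (U ⊗ₖ (1 : Matrix R R ℂ)) * ρ * (U ⊗ₖ (1 : Matrix R R ℂ)).conjTranspose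

/-! ### Two-party strategies with oracle calls -/

/-- The register of a party at time `i`: the input register of dimension `d` at time `0`, and
at time `i + 1` the tensor product of the register (of dimension `o i`) on which the oracle call
of that step acts and of a private memory (of dimension `m i`). -/
def Reg (d : ℕ) (o m : ℕ → ℕ) : ℕ → Type
  | 0 => Fin d
  | i + 1 => Fin (o i) × Fin (m i)

instance instFintypeReg (d : ℕ) (o m : ℕ → ℕ) : ∀ i, Fintype (Reg d o m i)
  | 0 => inferInstanceAs (Fintype (Fin d))
  | i + 1 => inferInstanceAs (Fintype (Fin (o i) × Fin (m i)))

instance instDecidableEqReg (d : ℕ) (o m : ℕ → ℕ) : ∀ i, DecidableEq (Reg d o m i)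
  | 0 => inferInstanceAs (DecidableEq (Fin d))
  | i + 1 => inferInstanceAs (DecidableEq (Fin (o i) × Fin (m i)))

/-- The `n` actions of one party, whose input register has dimension `d` and whose register for
the oracle call of the step from time `i` to time `i + 1` has dimension `o i`. Only the entries
with `i < n` matter; memory sizes are arbitrary. -/
structure Party (n d : ℕ) (o : ℕ → ℕ) where
  mem : ℕ → ℕ
  op : ∀ i : ℕ, SuperOp (Reg d o mem i) (Reg d o mem (i + 1))
  isOp : ∀ i < n, IsQuantumOp (op i)

/-- The register of the party at time `i`. -/
abbrev Party.Space {n d : ℕ} {o : ℕ → ℕ} (P : Party n d o) (i : ℕ) : Type := Reg d o P.mem i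

/-- `n`-step two-party strategies with oracle calls, with input registers of dimensions `dA`
and `dB`. Only the entries with `i < n` matter. -/
structure Strategy (n dA dB : ℕ) where
  oA : ℕ → ℕ
  oB : ℕ → ℕ
  alice : Party n dA oA
  bob : Party n dB oB
  oracle : ∀ i : ℕ, SuperOp (Fin (oA i) × Fin (oB i)) (Fin (oA i) × Fin (oB i))
  isOp : ∀ i < n, IsQuantumOp (oracle i)

namespace Strategy

variable {n dA dB : ℕ}

/-- The joint state after `i` steps on the input `ρ`; in each step both parties act on their
registers, and then the oracle is called. -/
def state (S : Strategy n dA dB) {R : Type} (ρ : Op ((Fin dA × Fin dB) × R)) :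
    ∀ i : ℕ, Op ((S.alice.Space i × S.bob.Space i) × R)
  | 0 => ρ
  | i + 1 => applyOracle (S.oracle i) (applyB (S.bob.op i) (applyA (S.alice.op i) (S.state ρ i)))

/-- The strategy in which Alice is replaced by the adversary `A'`. -/
def withAlice (S : Strategy n dA dB) (A' : Party n dA S.oA) : Strategy n dA dB :=
  { S with alice := A' }

/-- The strategy in which Bob is replaced by the adversary `B'`. -/
def withBob (S : Strategy n dA dB) (B' : Party n dB S.oB) : Strategy n dA dB :=
  { S with bob := B' }

end Strategy

/-! ### Communication oracles -/

/-- Communication from `X` to `Y`: the content of `X` is moved to `Y` (replacing what was there)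
along the identification `e` of the two registers, and `X` is reset to the basis state `x₀`. -/
def sendRight {X Y : Type} [DecidableEq X] [Fintype Y] (e : X ≃ Y) (x₀ : X) :
    SuperOp (X × Y) (X × Y) where
  toFun M := Matrix.of fun p p' =>
    if p.1 = x₀ ∧ p'.1 = x₀ then ∑ z, M (e.symm p.2, z) (e.symm p'.2, z) else 0
  map_add' M N := by
    ext p p'
    by_cases h : p.1 = x₀ ∧ p'.1 = x₀ <;> simp [h, Finset.sum_add_distrib]
  map_smul' c M := by
    ext p p'
    by_cases h : p.1 = x₀ ∧ p'.1 = x₀ <;> simp [h, Finset.mul_sum]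

/-- Communication from `Y` to `X`. -/
def sendLeft {X Y : Type} [DecidableEq Y] [Fintype X] (e : X ≃ Y) (y₀ : Y) :
    SuperOp (X × Y) (X × Y) where
  toFun M := Matrix.of fun p p' =>
    if p.2 = y₀ ∧ p'.2 = y₀ then ∑ z, M (z, e p.1) (z, e p'.1) else 0
  map_add' M N := by
    ext p p'
    by_cases h : p.2 = y₀ ∧ p'.2 = y₀ <;> simp [h, Finset.sum_add_distrib]
  map_smul' c M := by
    ext p p'
    by_cases h : p.2 = y₀ ∧ p'.2 = y₀ <;> simp [h, Finset.mul_sum]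

/-- Communication oracles, in either direction. -/
def IsCommunication {a b : ℕ} (O : SuperOp (Fin a × Fin b) (Fin a × Fin b)) : Prop :=
  (∃ (e : Fin a ≃ Fin b) (x₀ : Fin a), O = sendRight e x₀) ∨
    ∃ (e : Fin a ≃ Fin b) (y₀ : Fin b), O = sendLeft e y₀

/-- The bare model: every oracle call is a communication in one of the two directions. -/
def Strategy.IsBare {n dA dB : ℕ} (S : Strategy n dA dB) : Prop :=
  ∀ i < n, IsCommunication (S.oracle i)

/-! ### Protocols, correctness, specious adversaries, privacy -/

/-- The reference system, of dimension `dim A₀ · dim B₀`. -/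
abbrev Ref (dA dB : ℕ) : Type := Fin dA × Fin dB

/-- Operators on `A₀ ⊗ B₀ ⊗ R`. -/
abbrev InputOp (dA dB : ℕ) : Type := Op ((Fin dA × Fin dB) × Ref dA dB)

/-- An `n`-step two-party protocol: a strategy whose final registers are identified with the input
registers. -/
structure Protocol (n dA dB : ℕ) extends Strategy n dA dB where
  outA : alice.Space n ≃ Fin dA
  outB : bob.Space n ≃ Fin dB

namespace Protocol

variable {n dA dB : ℕ}

/-- The final state, as an operator on `A₀ ⊗ B₀ ⊗ R`. -/
def output (P : Protocol n dA dB) (ρ : InputOp dA dB) : InputOp dA dB :=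
  (P.state ρ n).submatrix
    (Prod.map (Prod.map P.outA.symm P.outB.symm) id)
    (Prod.map (Prod.map P.outA.symm P.outB.symm) id)

/-- `ε`-correctness of a protocol for the unitary `U`. -/
def IsCorrect (P : Protocol n dA dB) (U : Matrix.unitaryGroup (Fin dA × Fin dB) ℂ) (ε : ℝ) :
    Prop :=
  ∀ ρ : InputOp dA dB, IsState ρ → traceDist (P.output ρ) (applyU U.1 ρ) ≤ ε

/-- `ε`-specious adversaries replacing Alice. -/
def IsSpeciousA (P : Protocol n dA dB) (ε : ℝ) (A' : Party n dA P.oA) : Prop :=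
  ∃ T : ∀ i : ℕ, SuperOp (A'.Space i) (P.alice.Space i),
    (∀ i, 1 ≤ i → i ≤ n → IsQuantumOp (T i)) ∧
    ∀ ρ : InputOp dA dB, IsState ρ → ∀ i, 1 ≤ i → i ≤ n →
      traceDist (applyA (T i) ((P.withAlice A').state ρ i)) (P.state ρ i) ≤ ε

/-- `ε`-specious adversaries replacing Bob. -/
def IsSpeciousB (P : Protocol n dA dB) (ε : ℝ) (B' : Party n dB P.oB) : Prop :=
  ∃ T : ∀ i : ℕ, SuperOp (B'.Space i) (P.bob.Space i),
    (∀ i, 1 ≤ i → i ≤ n → IsQuantumOp (T i)) ∧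
    ∀ ρ : InputOp dA dB, IsState ρ → ∀ i, 1 ≤ i → i ≤ n →
      traceDist (applyB (T i) ((P.withBob B').state ρ i)) (P.state ρ i) ≤ ε

/-- Alice's simulated view: the ideal functionality `U` is called iff `q`, then `Φ` is applied
to her register, and Bob's register is discarded. -/
def viewA {Y : Type} (U : Matrix.unitaryGroup (Fin dA × Fin dB) ℂ) (q : Bool)
    (Φ : SuperOp (Fin dA) Y) (ρ : InputOp dA dB) : Op (Y × Ref dA dB) :=
  traceOutB (applyA Φ (if q then applyU U.1 ρ else ρ))

/-- Bob's simulated view. -/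
def viewB {Y : Type} (U : Matrix.unitaryGroup (Fin dA × Fin dB) ℂ) (q : Bool)
    (Φ : SuperOp (Fin dB) Y) (ρ : InputOp dA dB) : Op (Y × Ref dA dB) :=
  traceOutA (applyB Φ (if q then applyU U.1 ρ else ρ))

/-- `δ`-privacy against `ε`-specious adversaries replacing Alice: every such adversary has a
simulator, i.e. quantum operations `Φ i` and bits `q i`, which reproduces its view at every step
and on every input up to `δ`. -/
def IsPrivateA (P : Protocol n dA dB) (U : Matrix.unitaryGroup (Fin dA × Fin dB) ℂ) (δ ε : ℝ) :
    Prop :=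
  ∀ A' : Party n dA P.oA, P.IsSpeciousA ε A' →
    ∃ (Φ : ∀ i : ℕ, SuperOp (Fin dA) (A'.Space i)) (q : ℕ → Bool),
      (∀ i, 1 ≤ i → i ≤ n → IsQuantumOp (Φ i)) ∧
      ∀ ρ : InputOp dA dB, IsState ρ → ∀ i, 1 ≤ i → i ≤ n →
        traceDist (viewA U (q i) (Φ i) ρ) (traceOutB ((P.withAlice A').state ρ i)) ≤ δ

/-- `δ`-privacy against `ε`-specious adversaries replacing Bob. -/
def IsPrivateB (P : Protocol n dA dB) (U : Matrix.unitaryGroup (Fin dA × Fin dB) ℂ) (δ ε : ℝ) :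
    Prop :=
  ∀ B' : Party n dB P.oB, P.IsSpeciousB ε B' →
    ∃ (Φ : ∀ i : ℕ, SuperOp (Fin dB) (B'.Space i)) (q : ℕ → Bool),
      (∀ i, 1 ≤ i → i ≤ n → IsQuantumOp (Φ i)) ∧
      ∀ ρ : InputOp dA dB, IsState ρ → ∀ i, 1 ≤ i → i ≤ n →
        traceDist (viewB U (q i) (Φ i) ρ) (traceOutA ((P.withBob B').state ρ i)) ≤ δ

/-- `δ`-privacy against `ε`-specious adversaries. -/
def IsPrivate (P : Protocol n dA dB) (U : Matrix.unitaryGroup (Fin dA × Fin dB) ℂ) (δ ε : ℝ) :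
    Prop :=
  P.IsPrivateA U δ ε ∧ P.IsPrivateB U δ ε

end Protocol

/-- Statistical privacy of a family of protocols indexed by the security parameter `m ≥ 1`,
against `ε m`-specious adversaries: for some `γ > 0` the `m`-th protocol is
`2 ^ (-γ m)`-private. -/
def StatisticallyPrivate {dA dB : ℕ} {n : ℕ → ℕ} (P : ∀ m, Protocol (n m) dA dB)
    (U : Matrix.unitaryGroup (Fin dA × Fin dB) ℂ) (ε : ℕ → ℝ) : Prop :=
  ∃ γ : ℝ, 0 < γ ∧ ∀ m : ℕ, 1 ≤ m →
    (P m).IsPrivate U ((2 : ℝ) ^ (-γ * (m : ℝ))) (ε m)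

/-- The one-qubit swap gate `|a⟩|b⟩ ↦ |b⟩|a⟩`. -/
def swapGate : Matrix.unitaryGroup (Fin 2 × Fin 2) ℂ :=
  ⟨Matrix.of fun p p' => if p = p'.swap then 1 else 0, by
    rw [Matrix.mem_unitaryGroup_iff]
    ext ⟨a, b⟩ ⟨c, d⟩
    fin_cases a <;> fin_cases b <;> fin_cases c <;> fin_cases d <;>
      simp [Matrix.mul_apply, Fintype.sum_prod_type, Matrix.star_apply]⟩

end TwoParty

end

open scoped ComplexOrder MatrixOrder Kronecker

noncomputable section

namespace TwoParty

/-! The protocol is run on the input maximally entangled with two reference qubits, R_A (the partner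
of Alice's input) and R_B (the partner of Bob's), with both parties purified: they act by isometries
and keep every environment. Discarding the environments gives back the honest run exactly, so each
purified party, facing the honest other one, is specious for every `ε ≥ 0`, and its view does not
depend on whether the other is purified.

A communication discards the receiver's old register, which could destroy purity. The receiver
therefore first resets that register to a basis state, coherently; this is invisible after the
oracle, and the content goes to the receiver's environment. Hence the joint state of the two
purified parties and the reference is pure at every time (`IsBare.exists_purification`).

Privacy with bit 0 makes Alice's view decoupled from R_B, with bit 1 decoupled from R_A; for Bob the
roles are reversed. By monogamy (`IsPure.one_le_of_isDecoupled`) a qubit of the reference cannot be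
nearly decoupled from both parties of a pure state. Moreover the sender of a message changes its own
reduced state only by a local operation, so its decoupling persists.

It follows by induction that Alice is always decoupled from R_B. This is clear at time 0 and when
Alice sends. When Bob sends, monogamy forces Bob to be decoupled from R_A just before, hence also
just after; then Alice cannot be decoupled from R_A, and privacy leaves only R_B. At the end,
however, a swap must correlate Alice with R_B. Each induction step returns the same error `2 * δ`,
so nothing accumulates and the constant is independent of the number of steps.

Monogamy is proved by a matrix inequality (`trace_le_of_blocks`). Split the vector as a sum of |r⟩ ⊗
M_r, with r the value of the qubit. Decoupling from one party makes M_0 M_0† and M_1 M_1† close;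
decoupling from the other makes M_0† M_1 small. Comparing the trace of ρ_0 τ⁻¹ ρ_1, where ρ_r = M_r
M_r† and τ slightly dominates both, from above and below bounds the norm of the vector. -/

/-! ### Trace-norm bounds through positive decompositions -/

/-- `M` is a difference of two positive operators of total trace at most `c`; for Hermitian `M`
this says that its trace norm is at most `c`. -/
def HermBound {X : Type} [Fintype X] (M : Op X) (c : ℝ) : Prop :=
  ∃ P N : Op X, P.PosSemidef ∧ N.PosSemidef ∧ M = P - N ∧ (P.trace + N.trace).re ≤ c

theorem hermBound_of_traceNorm_le {X : Type} [Fintype X] [DecidableEq X] {M : Op X} {c : ℝ}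
    (hM : M.IsHermitian) (h : traceNorm M ≤ c) : HermBound M c := by
  have hs : IsSelfAdjoint M := hM
  refine ⟨M⁺, M⁻, ?_, ?_, (CFC.posPart_sub_negPart M hs).symm, ?_⟩
  · exact Matrix.nonneg_iff_posSemidef.1 (CFC.posPart_nonneg M)
  · exact Matrix.nonneg_iff_posSemidef.1 (CFC.negPart_nonneg M)
  · rwa [← Matrix.trace_add, CFC.posPart_add_negPart M hs]

theorem traceDist_self {X : Type} [Fintype X] [DecidableEq X] (M : Op X) : traceDist M M = 0 := by
  simp [traceDist, traceNorm]

theorem HermBound.of_traceDist_le {X : Type} [Fintype X] [DecidableEq X] {M N : Op X} {δ : ℝ}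
    (hM : M.PosSemidef) (hN : N.PosSemidef) (h : traceDist M N ≤ δ) :
    HermBound (M - N) (2 * δ) :=
  hermBound_of_traceNorm_le (hM.1.sub hN.1) (by unfold traceDist at h; linarith)

theorem HermBound.neg {X : Type} [Fintype X] {M N : Op X} {c : ℝ}
    (h : HermBound (M - N) c) : HermBound (N - M) c := by
  obtain ⟨P, Q, hP, hQ, h, hc⟩ := h
  exact ⟨Q, P, hQ, hP, by rw [← neg_sub, h, neg_sub], by rwa [add_comm]⟩

/-- The decomposition is pushed through termwise, so contractivity under positive trace-preserving
maps needs no norm inequality. -/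
theorem HermBound.map {X Y : Type} [Fintype X] [Fintype Y] {M : Op X} {c : ℝ}
    (h : HermBound M c) (Λ : Op X → Op Y) (hsub : ∀ A B, Λ (A - B) = Λ A - Λ B)
    (hpos : ∀ A, A.PosSemidef → (Λ A).PosSemidef) (htr : ∀ A, (Λ A).trace = A.trace) :
    HermBound (Λ M) c := by
  obtain ⟨P, N, hP, hN, h, hc⟩ := h
  exact ⟨Λ P, Λ N, hpos _ hP, hpos _ hN, by rw [h, hsub], by rwa [htr, htr]⟩

theorem exists_eq_conjTranspose_mul_self {X : Type} [Fintype X] {A : Op X}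
    (hA : A.PosSemidef) : ∃ C : Op X, A = C.conjTranspose * C := by
  classical
  obtain ⟨C, hC⟩ := CStarAlgebra.nonneg_iff_eq_star_mul_self.1 (Matrix.nonneg_iff_posSemidef.2 hA)
  exact ⟨C, hC⟩

theorem trace_mul_re_nonneg {X : Type} [Fintype X] {A B : Op X} (hA : A.PosSemidef)
    (hB : B.PosSemidef) : 0 ≤ (A * B).trace.re := by
  classical
  obtain ⟨C, rfl⟩ := exists_eq_conjTranspose_mul_self hB
  rw [← Matrix.mul_assoc, Matrix.trace_mul_comm, ← Matrix.mul_assoc]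
  have h := (hA.mul_mul_conjTranspose_same C).trace_nonneg
  exact (Complex.le_def.1 h).1

/-- Entries of a Gram matrix are inner products of columns; AM-GM bounds them by the squared norms
on the diagonal. -/
theorem PosSemidef.norm_entry_le {X : Type} [Fintype X] [DecidableEq X] {P : Op X}
    (hP : P.PosSemidef) (x y : X) : ‖P x y‖ ≤ P.trace.re := by
  obtain ⟨C, rfl⟩ := exists_eq_conjTranspose_mul_self hP
  have htr : (C.conjTranspose * C).trace.re = ∑ k, ∑ z, ‖C k z‖ ^ 2 := by
    rw [Finset.sum_comm]
    simp [Matrix.trace, Matrix.mul_apply, Complex.sq_norm, Complex.normSq_apply]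
  rw [htr, Matrix.mul_apply]
  refine (norm_sum_le _ _).trans (Finset.sum_le_sum fun k _ => ?_)
  have hx := Finset.single_le_sum (f := fun z => ‖C k z‖ ^ 2) (fun z _ => sq_nonneg _)
    (Finset.mem_univ x)
  have hy := Finset.single_le_sum (f := fun z => ‖C k z‖ ^ 2) (fun z _ => sq_nonneg _)
    (Finset.mem_univ y)
  simp only [Matrix.conjTranspose_apply, norm_mul, norm_star] at hx hy ⊢
  nlinarith [sq_nonneg (‖C k x‖ - ‖C k y‖)]

theorem HermBound.norm_entry_le {X : Type} [Fintype X] [DecidableEq X] {M : Op X} {c : ℝ}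
    (h : HermBound M c) (x y : X) : ‖M x y‖ ≤ c := by
  obtain ⟨P, N, hP, hN, rfl, hc⟩ := h
  have h₁ := PosSemidef.norm_entry_le hP x y
  have h₂ := PosSemidef.norm_entry_le hN x y
  have := norm_sub_le (P x y) (N x y)
  rw [Complex.add_re] at hc
  rw [Matrix.sub_apply]
  linarith

/-! ### Schur complements and the matrix form of monogamy -/

/-- Both positivity statements are Schur complement conditions for the block matrix with rows (τ, M)
and (M†, 1). -/
theorem conjTranspose_inv_mul_le_one {X Y : Type} [Fintype X] [DecidableEq X] [Fintype Y]
    [DecidableEq Y] {τ : Op X} (hτ : τ.PosDef) {M : Matrix X Y ℂ}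
    (h : (τ - M * M.conjTranspose).PosSemidef) :
    (1 - M.conjTranspose * τ⁻¹ * M).PosSemidef := by
  let _ := hτ.isUnit.invertible
  rw [← Matrix.PosDef.fromBlocks₁₁ M 1 hτ]
  let _ : Invertible (1 : Matrix Y Y ℂ) := invertibleOne
  rw [Matrix.PosDef.fromBlocks₂₂ τ M Matrix.PosDef.one]
  simpa using h

theorem mul_inv_mul_le {X : Type} [Fintype X] [DecidableEq X] {τ N : Op X} (hτ : τ.PosDef)
    (hN : N.PosSemidef) (h : (τ - N).PosSemidef) : (N - N * τ⁻¹ * N).PosSemidef := by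
  obtain ⟨C, rfl⟩ := exists_eq_conjTranspose_mul_self hN
  have := (conjTranspose_inv_mul_le_one hτ (M := C.conjTranspose) (by simpa using h))
  have := this.conjTranspose_mul_mul_same C
  simpa [Matrix.mul_sub, Matrix.sub_mul, Matrix.mul_assoc] using this

theorem trace_mul_prod_fin_two {Y : Type} [Fintype Y] (P H : Op (Y × Fin 2)) :
    (P * H).trace = ∑ r, ∑ s, ((Matrix.of fun y y' => P (y, r) (y', s)) *
      (Matrix.of fun y y' => H (y, s) (y', r)) : Op Y).trace := by
  simp only [Matrix.trace, Matrix.mul_apply, Matrix.diag_apply, Fintype.sum_prod_type,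
    Matrix.of_apply, Fin.sum_univ_two, Finset.sum_add_distrib]

/-- The signed off-diagonal blocks complete to a positive matrix whose diagonal blocks are at most
1; pairing it with `P` bounds the off-diagonal part by the trace of `P`. -/
theorem trace_block_le {X Y : Type} [Fintype X] [DecidableEq X] [Fintype Y]
    [DecidableEq Y] {τ : Op X} (hτ : τ.PosDef) (M : Fin 2 → Matrix X Y ℂ)
    (h : ∀ r, (τ - M r * (M r).conjTranspose).PosSemidef) {P : Op (Y × Fin 2)}
    (hP : P.PosSemidef) (σ : ℂ) (hσ : σ = 1 ∨ σ = -1) :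
    (σ * (((Matrix.of fun y y' => P (y, 0) (y', 1)) * ((M 1).conjTranspose * τ⁻¹ * M 0)).trace +
      ((Matrix.of fun y y' => P (y, 1) (y', 0)) *
        ((M 0).conjTranspose * τ⁻¹ * M 1)).trace)).re ≤ P.trace.re := by
  -- The relative sign makes the off-diagonal blocks of the Gram matrix appear with the factor `-σ`.
  let ε : Fin 2 → ℂ := ![1, -σ]
  let B : Matrix X (Y × Fin 2) ℂ := Matrix.of fun x p => ε p.2 * M p.2 x p.1
  have hH := hτ.inv.posSemidef.conjTranspose_mul_mul_same B
  have h0 := trace_mul_re_nonneg hP hH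
  have hB : ∀ r s, (Matrix.of fun y y' => (B.conjTranspose * τ⁻¹ * B) (y, s) (y', r)) =
      (star (ε s) * ε r) • ((M s).conjTranspose * τ⁻¹ * M r) := by
    intro r s
    ext y y'
    simp only [B, Matrix.mul_apply, Matrix.of_apply, Matrix.conjTranspose_apply,
      Matrix.smul_apply, smul_eq_mul, Finset.mul_sum, Finset.sum_mul, star_mul']
    refine Finset.sum_congr rfl fun _ _ => Finset.sum_congr rfl fun _ _ => ?_
    ring
  rw [trace_mul_prod_fin_two] at h0
  simp only [hB, Matrix.mul_smul, Matrix.trace_smul, Fin.sum_univ_two] at h0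
  have hd : ∀ r, ((Matrix.of fun y y' => P (y, r) (y', r)) *
      ((M r).conjTranspose * τ⁻¹ * M r)).trace.re ≤
      (Matrix.of fun y y' => P (y, r) (y', r)).trace.re := by
    intro r
    have h1 := trace_mul_re_nonneg (hP.submatrix fun y : Y => (y, r))
      (conjTranspose_inv_mul_le_one hτ (h r))
    rw [Matrix.mul_sub, Matrix.trace_sub, Matrix.mul_one, Complex.sub_re] at h1
    exact sub_nonneg.1 h1
  have hd0 := hd 0
  have hd1 := hd 1
  have htr : P.trace = (Matrix.of fun y y' => P (y, 0) (y', 0)).trace +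
      (Matrix.of fun y y' => P (y, 1) (y', 1)).trace := by
    simp [Matrix.trace, Fintype.sum_prod_type, Finset.sum_add_distrib]
  rw [htr, Complex.add_re]
  rcases hσ with rfl | rfl <;> simp [ε] at h0 ⊢ <;> linarith

/-- If the reductions of a vector `Σ_r |r⟩ ⊗ M r` to its first factor agree for `r = 0, 1` up to
`P - N`, and the off-diagonal blocks of its reduction to the second factor are those of
`P' - N'`, then the norm of the vector is small. -/
theorem trace_le_of_blocks {X Y : Type} [Fintype X] [Fintype Y]
    (M : Fin 2 → Matrix X Y ℂ) {P N : Op X} (hP : P.PosSemidef) (hN : N.PosSemidef)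
    (hD : M 0 * (M 0).conjTranspose - M 1 * (M 1).conjTranspose = P - N)
    {P' N' : Op (Y × Fin 2)} (hP' : P'.PosSemidef) (hN' : N'.PosSemidef)
    (hoff : ∀ r s, r ≠ s → (M r).conjTranspose * M s =
      Matrix.of fun y y' => P' (y, r) (y', s) - N' (y, r) (y', s)) :
    ((M 0 * (M 0).conjTranspose).trace + (M 1 * (M 1).conjTranspose).trace).re ≤
      (P'.trace + N'.trace).re + 2 * (P.trace + N.trace).re := by
  classical
  -- The multiple `η` of the identity makes τ invertible; it is sent to 0 at the end.
  have key : ∀ η : ℝ, 0 < η →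
      ((M 0 * (M 0).conjTranspose).trace + (M 1 * (M 1).conjTranspose).trace).re ≤
      (P'.trace + N'.trace).re + 2 * (P.trace + N.trace).re + η * (4 * Fintype.card X) := by
    intro η hη
    set ρ₀ := M 0 * (M 0).conjTranspose with hρ₀
    set ρ₁ := M 1 * (M 1).conjTranspose with hρ₁
    have hI : ((η : ℂ) • (1 : Op X)).PosDef :=
      Matrix.PosDef.one.smul (by exact_mod_cast hη)
    set A : Op X := N + (η : ℂ) • 1 with hA
    set B : Op X := P + (η : ℂ) • 1 with hB
    have hAp : A.PosDef := Matrix.PosDef.posSemidef_add hN hI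
    have hBp : B.PosDef := Matrix.PosDef.posSemidef_add hP hI
    have hτ : (ρ₀ + A).PosDef :=
      Matrix.PosDef.posSemidef_add (Matrix.posSemidef_self_mul_conjTranspose _) hAp
    set τ := ρ₀ + A with hτd
    -- ρ₀ + N = ρ₁ + P, so a single τ dominates both reductions.
    have hτ' : τ = ρ₁ + B := by
      rw [hτd, hA, hB, ← add_assoc, ← add_assoc, ← sub_eq_zero]
      have : ρ₀ - ρ₁ - (P - N) = 0 := sub_eq_zero.2 hD
      rw [← this]; abel
    have hM : ∀ r, (τ - M r * (M r).conjTranspose).PosSemidef := by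
      intro r
      fin_cases r
      · have : τ - ρ₀ = A := by rw [hτd]; abel
        exact this ▸ hAp.posSemidef
      · have : τ - ρ₁ = B := by rw [hτ']; abel
        exact this ▸ hBp.posSemidef
    have h₁ := trace_block_le hτ M hM hP' 1 (Or.inl rfl)
    have h₂ := trace_block_le hτ M hM hN' (-1) (Or.inr rfl)
    have e01 : (Matrix.of fun y y' => P' (y, 0) (y', 1)) =
        (M 0).conjTranspose * M 1 + Matrix.of fun y y' => N' (y, 0) (y', 1) := by
      rw [hoff 0 1 (by decide)]; ext; simp
    have e10 : (Matrix.of fun y y' => P' (y, 1) (y', 0)) =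
        (M 1).conjTranspose * M 0 + Matrix.of fun y y' => N' (y, 1) (y', 0) := by
      rw [hoff 1 0 (by decide)]; ext; simp
    have t01 : ((M 0).conjTranspose * M 1 * ((M 1).conjTranspose * τ⁻¹ * M 0)).trace =
        (ρ₁ * τ⁻¹ * ρ₀).trace := by
      rw [hρ₀, hρ₁, Matrix.mul_assoc, Matrix.trace_mul_comm]; simp only [Matrix.mul_assoc]
    have t10 : ((M 1).conjTranspose * M 0 * ((M 0).conjTranspose * τ⁻¹ * M 1)).trace =
        (ρ₀ * τ⁻¹ * ρ₁).trace := by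
      rw [hρ₀, hρ₁, Matrix.mul_assoc, Matrix.trace_mul_comm]; simp only [Matrix.mul_assoc]
    -- Upper bound: cyclicity turns these traces into pairings with the off-diagonal blocks of `P'`
    -- minus those of `N'`.
    have hsum : (ρ₁ * τ⁻¹ * ρ₀).trace.re + (ρ₀ * τ⁻¹ * ρ₁).trace.re ≤
        (P'.trace + N'.trace).re := by
      rw [e01, e10, Matrix.add_mul, Matrix.add_mul, Matrix.trace_add, Matrix.trace_add, t01,
        t10] at h₁
      simp only [one_mul, neg_mul, Complex.add_re, Complex.neg_re] at h₁ h₂ ⊢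
      linarith
    have hu : IsUnit τ.det := (Matrix.isUnit_iff_isUnit_det _).1 hτ.isUnit
    have x0 : ρ₀ = τ - A := by rw [hτd]; abel
    have x1 : ρ₁ = τ - B := by rw [hτ']; abel
    have y01 : ρ₀ * τ⁻¹ * ρ₁ = τ - A - B + A * τ⁻¹ * B := by
      rw [x0, x1, Matrix.sub_mul, Matrix.mul_nonsing_inv _ hu, Matrix.mul_sub, Matrix.sub_mul,
        Matrix.sub_mul, Matrix.one_mul, Matrix.one_mul, Matrix.mul_assoc A,
        Matrix.nonsing_inv_mul _ hu, Matrix.mul_one]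
      abel
    have y10 : ρ₁ * τ⁻¹ * ρ₀ = τ - A - B + B * τ⁻¹ * A := by
      rw [x0, x1, Matrix.sub_mul, Matrix.mul_nonsing_inv _ hu, Matrix.mul_sub, Matrix.sub_mul,
        Matrix.sub_mul, Matrix.one_mul, Matrix.one_mul, Matrix.mul_assoc B,
        Matrix.nonsing_inv_mul _ hu, Matrix.mul_one]
      abel
    have hAA := (mul_inv_mul_le hτ hAp.posSemidef (by
      have : τ - A = ρ₀ := by rw [hτd]; abel
      exact this ▸ Matrix.posSemidef_self_mul_conjTranspose _)).trace_nonneg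
    have hBB := (mul_inv_mul_le hτ hBp.posSemidef (by
      have : τ - B = ρ₁ := by rw [hτ']; abel
      exact this ▸ Matrix.posSemidef_self_mul_conjTranspose _)).trace_nonneg
    -- Lower bound: positivity of (A + B) τ⁻¹ (A + B) controls the cross terms by A τ⁻¹ A and B τ⁻¹
    -- B, whose traces are at most those of A and B.
    have hAB := (hτ.inv.posSemidef.mul_mul_conjTranspose_same (A + B)).trace_nonneg
    rw [(hAp.add hBp).1.eq] at hAB
    simp only [Matrix.add_mul, Matrix.mul_add, Matrix.trace_add, Matrix.trace_sub,
      Complex.le_def, Complex.add_re, Complex.sub_re, Complex.zero_re] at hAA hBB hAB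
    have r0 := congrArg (fun M : Op X => M.trace.re) hτd
    have r1 := congrArg (fun M : Op X => M.trace.re) hτ'
    have rA := congrArg (fun M : Op X => M.trace.re) hA
    have rB := congrArg (fun M : Op X => M.trace.re) hB
    simp only [Matrix.trace_add, Matrix.trace_smul, Matrix.trace_one, Complex.add_re,
      smul_eq_mul, Complex.mul_re, Complex.ofReal_re, Complex.ofReal_im, zero_mul, sub_zero,
      Complex.natCast_re] at r0 r1 rA rB
    rw [y01, y10] at hsum
    simp only [Matrix.trace_add, Matrix.trace_sub, Complex.add_re, Complex.sub_re] at hsum ⊢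
    linarith [hAA.1, hBB.1, hAB.1]
  refine le_of_forall_pos_le_add fun ε hε => ?_
  have hd : (0 : ℝ) < 4 * Fintype.card X + 1 := by positivity
  refine (key (ε / (4 * Fintype.card X + 1)) (div_pos hε hd)).trans ?_
  gcongr
  rw [div_mul_eq_mul_div, div_le_iff₀ hd]
  nlinarith

/-! ### Quantum operations and Kraus representations -/

theorem superOp_apply_eq_sum {X Y : Type} [Fintype X] [DecidableEq X] (Φ : SuperOp X Y)
    (M : Op X) (y y' : Y) :
    Φ M y y' = ∑ x, ∑ x', M x x' * Φ (Matrix.single x x' 1) y y' := by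
  conv_lhs => rw [Matrix.matrix_eq_sum_single M]
  simp only [map_sum, Matrix.sum_apply]
  refine Finset.sum_congr rfl fun x _ => Finset.sum_congr rfl fun x' _ => ?_
  have : Matrix.single x x' (M x x') = M x x' • Matrix.single x x' (1 : ℂ) := by
    rw [Matrix.smul_single, smul_eq_mul, mul_one]
  rw [this, map_smul, Matrix.smul_apply, smul_eq_mul]

theorem IsQuantumOp.tensorId_posSemidef {X Y Z : Type} [Fintype X] [Fintype Y] [Fintype Z]
    {Φ : SuperOp X Y} (h : IsQuantumOp Φ) {M : Op (X × Z)} (hM : M.PosSemidef) :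
    (tensorId Z Φ M).PosSemidef := by
  classical
  let e := Fintype.equivFin Z
  have h1 := h.1 _ _ (hM.submatrix (Prod.map id e.symm : X × Fin _ → X × Z))
  have h2 := h1.submatrix (Prod.map id e : Y × Z → Y × Fin _)
  convert h2 using 1
  ext p p'
  simp [tensorId]

theorem IsQuantumOp.tensorId_trace {X Y Z : Type} [Fintype X] [Fintype Y] [Fintype Z]
    {Φ : SuperOp X Y} (h : IsQuantumOp Φ) (M : Op (X × Z)) :
    (tensorId Z Φ M).trace = M.trace := by
  simp only [Matrix.trace, Matrix.diag_apply, Fintype.sum_prod_type_right]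
  exact Finset.sum_congr rfl fun z _ => h.2 (Matrix.of fun x x' => M (x, z) (x', z))

theorem IsQuantumOp.comp {X Y Z : Type} [Fintype X] [Fintype Y] [Fintype Z]
    {Ψ : SuperOp Y Z} {Φ : SuperOp X Y} (hΨ : IsQuantumOp Ψ) (hΦ : IsQuantumOp Φ) :
    IsQuantumOp (Ψ ∘ₗ Φ) :=
  ⟨fun k M hM => hΨ.1 k _ (hΦ.1 k M hM), fun M => (hΨ.2 _).trans (hΦ.2 M)⟩

theorem isQuantumOp_id {X : Type} [Fintype X] : IsQuantumOp (LinearMap.id : SuperOp X X) :=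
  ⟨fun _ _ hM => hM, fun _ => rfl⟩

/-- The completely positive map `M ↦ V M V†`. -/
def conjMap {X Y : Type} [Fintype X] (V : Matrix Y X ℂ) : SuperOp X Y where
  toFun M := V * M * V.conjTranspose
  map_add' M N := by rw [Matrix.mul_add, Matrix.add_mul]
  map_smul' c M := by simp

theorem conjMap_apply {X Y : Type} [Fintype X] (V : Matrix Y X ℂ) (M : Op X) :
    conjMap V M = V * M * V.conjTranspose := rfl

theorem conjMap_entry {X Y : Type} [Fintype X] (V : Matrix Y X ℂ) (M : Op X) (y y' : Y) :
    conjMap V M y y' = ∑ x, ∑ x', V y x * M x x' * star (V y' x') := by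
  simp only [conjMap_apply, Matrix.mul_apply, Matrix.conjTranspose_apply, Finset.sum_mul]
  rw [Finset.sum_comm]

theorem isQuantumOp_conjMap {X Y : Type} [Fintype X] [DecidableEq X] [Fintype Y]
    {V : Matrix Y X ℂ} (hV : V.conjTranspose * V = 1) : IsQuantumOp (conjMap V) := by
  classical
  refine ⟨fun k M hM => ?_, fun M => ?_⟩
  · have := hM.mul_mul_conjTranspose_same (V ⊗ₖ (1 : Matrix (Fin k) (Fin k) ℂ))
    convert this using 1
    ext ⟨y, z⟩ ⟨y', z'⟩
    simp only [tensorId, Matrix.of_apply, conjMap_entry]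
    simp only [Matrix.mul_apply, Matrix.conjTranspose_apply, Matrix.kronecker_apply,
      Matrix.one_apply, Fintype.sum_prod_type, Finset.sum_mul, mul_ite, mul_one, mul_zero,
      ite_mul, zero_mul, apply_ite star, star_zero, Finset.sum_ite_eq, Finset.mem_univ, if_true]
    rw [Finset.sum_comm]
    refine Finset.sum_congr rfl fun _ _ => ?_
    rw [Finset.sum_comm]
    simp
  · rw [conjMap_apply, Matrix.trace_mul_comm, ← Matrix.mul_assoc, hV, Matrix.one_mul]

/-- Partial trace over the second register. -/
def traceSnd (Y E : Type) [Fintype E] : SuperOp (Y × E) Y where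
  toFun M := Matrix.of fun y y' => ∑ e, M (y, e) (y', e)
  map_add' M N := by ext; simp [Finset.sum_add_distrib]
  map_smul' c M := by ext; simp [Finset.mul_sum]

theorem isQuantumOp_traceSnd (Y E : Type) [Fintype Y] [Fintype E] :
    IsQuantumOp (traceSnd Y E) := by
  refine ⟨fun k M hM => ?_, fun M => ?_⟩
  · have : tensorId (Fin k) (traceSnd Y E) M =
        ∑ e, M.submatrix (fun p => ((p.1, e), p.2)) fun p => ((p.1, e), p.2) := by
      ext p p'
      simp [tensorId, traceSnd, Matrix.sum_apply]
    rw [this]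
    exact Matrix.posSemidef_sum _ fun e _ => hM.submatrix _
  · simp [traceSnd, Matrix.trace, Fintype.sum_prod_type]

/-- Reindexing of a register. -/
def reindexOp {X Y : Type} (e : Y ≃ X) : SuperOp X Y where
  toFun M := M.submatrix e e
  map_add' _ _ := rfl
  map_smul' _ _ := rfl

theorem isQuantumOp_reindexOp {X Y : Type} [Fintype X] [Fintype Y] (e : Y ≃ X) :
    IsQuantumOp (reindexOp e) :=
  ⟨fun k _ hM => hM.submatrix fun p : Y × Fin k => (e p.1, p.2),
    fun M => Equiv.sum_comp e fun x => M x x⟩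

/-- Reset of the first register to a basis state. -/
def resetFst {O M : Type} [Fintype O] [DecidableEq O] (o : O) : SuperOp (O × M) (O × M) where
  toFun N := Matrix.of fun p p' =>
    if p.1 = o ∧ p'.1 = o then ∑ z, N (z, p.2) (z, p'.2) else 0
  map_add' M N := by
    ext p p'
    by_cases h : p.1 = o ∧ p'.1 = o <;> simp [h, Finset.sum_add_distrib]
  map_smul' c M := by
    ext p p'
    by_cases h : p.1 = o ∧ p'.1 = o <;> simp [h, Finset.mul_sum]

theorem isQuantumOp_resetFst {O M : Type} [Fintype O] [DecidableEq O] [Fintype M] (o : O) :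
    IsQuantumOp (resetFst o : SuperOp (O × M) (O × M)) := by
  classical
  refine ⟨fun k N hN => ?_, fun N => ?_⟩
  · let D : Op ((O × M) × Fin k) := Matrix.diagonal fun p => if p.1.1 = o then 1 else 0
    have hD : D.conjTranspose = D := by
      rw [Matrix.diagonal_conjTranspose]
      congr 1
      ext p
      by_cases h : p.1.1 = o <;> simp [h]
    have : tensorId (Fin k) (resetFst o) N = D * (∑ z, N.submatrix (fun p => ((z, p.1.2), p.2))
        fun p => ((z, p.1.2), p.2)) * D.conjTranspose := by
      rw [hD]
      ext p p'
      by_cases h : p.1.1 = o <;> by_cases h' : p'.1.1 = o <;>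
        simp [tensorId, resetFst, D, Matrix.sum_apply, h, h']
    rw [this]
    exact (Matrix.posSemidef_sum _ fun e _ => hN.submatrix _).mul_mul_conjTranspose_same _
  · simp only [resetFst, LinearMap.coe_mk, AddHom.coe_mk, Matrix.trace, Fintype.sum_prod_type,
      Matrix.diag_apply, Matrix.of_apply, and_self]
    rw [Finset.sum_comm]
    rw [Finset.sum_comm (f := fun z m => N (z, m) (z, m))]
    simp

/-- Kraus representation of a quantum operation. -/
theorem IsQuantumOp.exists_kraus {X Y : Type} [Fintype X] [DecidableEq X] [Fintype Y]
    {Φ : SuperOp X Y} (h : IsQuantumOp Φ) :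
    ∃ (k : ℕ) (K : Fin k → Matrix Y X ℂ),
      (∀ M, Φ M = ∑ j, conjMap (K j) M) ∧ ∑ j, (K j).conjTranspose * K j = 1 := by
  classical
  -- Unnormalised maximally entangled vector: its image is the Choi matrix, and the rows of a Gram
  -- factor of it are the conjugated Kraus operators.
  let Ω : Op (X × X) := Matrix.vecMulVec (fun p => if p.1 = p.2 then 1 else 0)
    (star fun p => if p.1 = p.2 then 1 else 0)
  have hΩ : Ω.PosSemidef := Matrix.posSemidef_vecMulVec_self_star _
  obtain ⟨C, hC⟩ := exists_eq_conjTranspose_mul_self (h.tensorId_posSemidef hΩ)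
  have hE : ∀ x x', (Matrix.of fun a a' => Ω (a, x) (a', x')) = Matrix.single x x' (1 : ℂ) := by
    intro x x'
    ext a a'
    by_cases h1 : a = x <;> by_cases h2 : a' = x' <;>
      simp [Ω, Matrix.vecMulVec_apply, Matrix.single_apply, h1, h2, eq_comm]
    all_goals aesop
  have hΦ : ∀ x x' y y', Φ (Matrix.single x x' 1) y y' = ∑ j, star (C j (y, x)) * C j (y', x') := by
    intro x x' y y'
    have := congrFun (congrFun hC (y, x)) (y', x')
    simpa [tensorId, hE, Matrix.mul_apply] using this
  let e := Fintype.equivFin (Y × X)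
  let K : Y × X → Matrix Y X ℂ := fun j => Matrix.of fun y x => star (C j (y, x))
  refine ⟨Fintype.card (Y × X), fun j => K (e.symm j), fun M => ?_, ?_⟩
  · rw [e.symm.sum_comp fun j => conjMap (K j) M]
    ext y y'
    rw [superOp_apply_eq_sum, Matrix.sum_apply]
    simp only [conjMap_entry, hΦ, Finset.mul_sum]
    symm
    rw [Finset.sum_comm]
    refine Finset.sum_congr rfl fun x _ => ?_
    rw [Finset.sum_comm]
    refine Finset.sum_congr rfl fun x' _ => Finset.sum_congr rfl fun j _ => ?_
    simp only [K, Matrix.of_apply, star_star]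
    ring
  · rw [e.symm.sum_comp fun j => (K j).conjTranspose * K j]
    ext x x'
    have h1 := h.2 (Matrix.single x' x 1)
    have h2 : (Matrix.single x' x (1 : ℂ)).trace = if x = x' then 1 else 0 := by
      by_cases hx : x = x' <;> simp [hx, Matrix.trace_single_eq_of_ne, eq_comm]
    rw [Matrix.one_apply, ← h2, ← h1, Matrix.sum_apply]
    simp only [Matrix.trace, Matrix.diag_apply, hΦ, K, Matrix.mul_apply,
      Matrix.conjTranspose_apply, Matrix.of_apply, star_star]
    rw [Finset.sum_comm]
    simp only [mul_comm]

/-! ### Local operations and partial traces -/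

theorem applyA_applyB_comm {A A' B B' R : Type} [Fintype A] [Fintype B]
    (Φ : SuperOp A A') (Ψ : SuperOp B B') (M : Op ((A × B) × R)) :
    applyB Ψ (applyA Φ M) = applyA Φ (applyB Ψ M) := by
  classical
  ext p p'
  simp only [applyA, applyB, Matrix.of_apply]
  rw [superOp_apply_eq_sum Ψ, superOp_apply_eq_sum Φ]
  simp only [Matrix.of_apply]
  simp only [superOp_apply_eq_sum Ψ (Matrix.of _), superOp_apply_eq_sum Φ (Matrix.of _),
    Matrix.of_apply, Finset.sum_mul]
  rw [Finset.sum_congr rfl fun _ _ => Finset.sum_comm, Finset.sum_comm,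
    Finset.sum_congr rfl fun _ _ => Finset.sum_congr rfl fun _ _ => Finset.sum_comm,
    Finset.sum_congr rfl fun _ _ => Finset.sum_comm]
  refine Finset.sum_congr rfl fun _ _ => Finset.sum_congr rfl fun _ _ =>
    Finset.sum_congr rfl fun _ _ => Finset.sum_congr rfl fun _ _ => ?_
  ring

theorem traceOutB_applyA {A A' B R : Type} [Fintype B] (Φ : SuperOp A A')
    (M : Op ((A × B) × R)) : traceOutB (applyA Φ M) = tensorId R Φ (traceOutB M) := by
  ext p p'
  have : (Matrix.of fun x x' => traceOutB M (x, p.2) (x', p'.2)) =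
      ∑ b, Matrix.of fun x x' => M ((x, b), p.2) ((x', b), p'.2) := by
    ext; simp [traceOutB, Matrix.sum_apply]
  simp only [tensorId, Matrix.of_apply, this, map_sum, Matrix.sum_apply]
  rfl

theorem traceOutA_applyB {A B B' R : Type} [Fintype A] (Φ : SuperOp B B')
    (M : Op ((A × B) × R)) : traceOutA (applyB Φ M) = tensorId R Φ (traceOutA M) := by
  ext p p'
  have : (Matrix.of fun x x' => traceOutA M (x, p.2) (x', p'.2)) =
      ∑ a, Matrix.of fun x x' => M ((a, x), p.2) ((a, x'), p'.2) := by
    ext; simp [traceOutA, Matrix.sum_apply]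
  simp only [tensorId, Matrix.of_apply, this, map_sum, Matrix.sum_apply]
  rfl

theorem traceOutB_applyB {A B B' R : Type} [Fintype B] [Fintype B'] {Φ : SuperOp B B'}
    (hΦ : ∀ N, (Φ N).trace = N.trace) (M : Op ((A × B) × R)) :
    traceOutB (applyB Φ M) = traceOutB M := by
  ext p p'
  exact hΦ (Matrix.of fun y y' => M ((p.1, y), p.2) ((p'.1, y'), p'.2))

theorem traceOutA_applyA {A A' B R : Type} [Fintype A] [Fintype A'] {Φ : SuperOp A A'}
    (hΦ : ∀ N, (Φ N).trace = N.trace) (M : Op ((A × B) × R)) :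
    traceOutA (applyA Φ M) = traceOutA M := by
  ext p p'
  exact hΦ (Matrix.of fun x x' => M ((x, p.1), p.2) ((x', p'.1), p'.2))

/-! ### Partial traces over private registers -/

/-- `T` is the partial trace over the second factor of the private memory. -/
def IsEnvTrace {O : Type} {m e : ℕ} (T : SuperOp (O × Fin (m * e)) (O × Fin m)) : Prop :=
  ∀ N p p', T N p p' =
    ∑ j, N (p.1, finProdFinEquiv (p.2, j)) (p'.1, finProdFinEquiv (p'.2, j))

/-- The oracle does not touch the private memory, where the traced-out factor lives. -/
theorem applyA_applyOracle_comm {AO BO B' R : Type} [Fintype AO] [Fintype BO] {m e : ℕ}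
    {T : SuperOp (AO × Fin (m * e)) (AO × Fin m)} (hT : IsEnvTrace T)
    (O : SuperOp (AO × BO) (AO × BO)) (M : Op (((AO × Fin (m * e)) × (BO × B')) × R)) :
    applyA T (applyOracle O M) = applyOracle O (applyA T M) := by
  ext p p'
  simp only [applyA, applyOracle, Matrix.of_apply, hT _ _ _]
  rw [← Matrix.sum_apply _ _ Finset.univ fun j => O _, ← map_sum]
  refine congrFun (congrFun (congrArg O ?_) _) _
  ext u u'
  simp [Matrix.sum_apply]

theorem applyB_applyOracle_comm {AO BO A' R : Type} [Fintype AO] [Fintype BO] {m e : ℕ}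
    {T : SuperOp (BO × Fin (m * e)) (BO × Fin m)} (hT : IsEnvTrace T)
    (O : SuperOp (AO × BO) (AO × BO)) (M : Op (((AO × A') × (BO × Fin (m * e))) × R)) :
    applyB T (applyOracle O M) = applyOracle O (applyB T M) := by
  ext p p'
  simp only [applyB, applyOracle, Matrix.of_apply, hT _ _ _]
  rw [← Matrix.sum_apply _ _ Finset.univ fun j => O _, ← map_sum]
  refine congrFun (congrFun (congrArg O ?_) _) _
  ext u u'
  simp [Matrix.sum_apply]

/-! ### Communication oracles -/

/-- The receiver's register is about to be discarded, so resetting it first changes nothing. -/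
theorem applyOracle_sendRight_resetFst {AO A' BO B' R : Type}
    [DecidableEq AO] [Fintype BO] [DecidableEq BO]
    (e : AO ≃ BO) (x₀ : AO) (y₀ : BO)
    (M : Op (((AO × A') × (BO × B')) × R)) :
    applyOracle (sendRight e x₀) (applyB (resetFst y₀) M) = applyOracle (sendRight e x₀) M := by
  ext p p'
  simp [applyOracle, sendRight, applyB, resetFst]

theorem applyOracle_sendLeft_resetFst {AO A' BO B' R : Type}
    [Fintype AO] [DecidableEq AO] [DecidableEq BO]
    (e : AO ≃ BO) (x₀ : AO) (y₀ : BO)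
    (M : Op (((AO × A') × (BO × B')) × R)) :
    applyOracle (sendLeft e y₀) (applyA (resetFst x₀) M) = applyOracle (sendLeft e y₀) M := by
  ext p p'
  simp [applyOracle, sendLeft, applyA, resetFst]

/-- The sender only loses its oracle register: its reduced state undergoes a local reset, whatever
the receiver holds. -/
theorem traceOutB_applyOracle_sendRight {AO A' BO B' R : Type}
    [Fintype AO] [DecidableEq AO] [Fintype BO]
    [Fintype B'] (e : AO ≃ BO) (x₀ : AO)
    (M : Op (((AO × A') × (BO × B')) × R)) :
    traceOutB (applyOracle (sendRight e x₀) M) = tensorId R (resetFst x₀) (traceOutB M) := by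
  ext p p'
  simp only [traceOutB, applyOracle, sendRight, tensorId, resetFst, Matrix.of_apply,
    LinearMap.coe_mk, AddHom.coe_mk, Fintype.sum_prod_type]
  split_ifs
  · rw [← e.sum_comp]
    simp only [Equiv.symm_apply_apply]
    exact Finset.sum_congr rfl fun _ _ => Finset.sum_comm
  · simp

theorem traceOutA_applyOracle_sendLeft {AO A' BO B' R : Type}
    [Fintype AO] [Fintype BO] [DecidableEq BO]
    [Fintype A'] (e : AO ≃ BO) (y₀ : BO)
    (M : Op (((AO × A') × (BO × B')) × R)) :
    traceOutA (applyOracle (sendLeft e y₀) M) = tensorId R (resetFst y₀) (traceOutA M) := by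
  ext p p'
  simp only [traceOutA, applyOracle, sendLeft, tensorId, resetFst, Matrix.of_apply,
    LinearMap.coe_mk, AddHom.coe_mk, Fintype.sum_prod_type]
  split_ifs
  · rw [← e.symm.sum_comp]
    simp only [Equiv.apply_symm_apply]
    exact Finset.sum_congr rfl fun _ _ => Finset.sum_comm
  · simp

/-! ### Pure states -/

/-- Rank-one positive operators. -/
def IsPure {X : Type} (M : Op X) : Prop :=
  ∃ ψ : X → ℂ, ∀ p p', M p p' = ψ p * star (ψ p')

theorem IsPure.posSemidef {X : Type} [Fintype X] {M : Op X} (h : IsPure M) : M.PosSemidef := by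
  obtain ⟨ψ, h⟩ := h
  have : M = Matrix.vecMulVec ψ (star ψ) := by ext; exact h _ _
  rw [this]
  exact Matrix.posSemidef_vecMulVec_self_star ψ

theorem IsPure.applyA {A A' B R : Type} [Fintype A] {M : Op ((A × B) × R)} (h : IsPure M)
    (V : Matrix A' A ℂ) : IsPure (applyA (conjMap V) M) := by
  obtain ⟨ψ, h⟩ := h
  refine ⟨fun p => ∑ a, V p.1.1 a * ψ ((a, p.1.2), p.2), fun p p' => ?_⟩
  simp only [TwoParty.applyA, Matrix.of_apply, conjMap_entry, h, star_sum, Finset.sum_mul_sum]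
  refine Finset.sum_congr rfl fun _ _ => Finset.sum_congr rfl fun _ _ => ?_
  rw [star_mul']; ring

theorem IsPure.applyB {A B B' R : Type} [Fintype B] {M : Op ((A × B) × R)} (h : IsPure M)
    (V : Matrix B' B ℂ) : IsPure (applyB (conjMap V) M) := by
  obtain ⟨ψ, h⟩ := h
  refine ⟨fun p => ∑ b, V p.1.2 b * ψ ((p.1.1, b), p.2), fun p p' => ?_⟩
  simp only [TwoParty.applyB, Matrix.of_apply, conjMap_entry, h, star_sum, Finset.sum_mul_sum]
  refine Finset.sum_congr rfl fun _ _ => Finset.sum_congr rfl fun _ _ => ?_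
  rw [star_mul']; ring

/-- The sum over the receiver's old content would in general be a mixture; `h₀` leaves only the term
`y₀`. -/
theorem IsPure.sendRight {AO A' BO B' R : Type} [DecidableEq AO] [Fintype BO]
    {M : Op (((AO × A') × (BO × B')) × R)} (h : IsPure M)
    (e : AO ≃ BO) (x₀ : AO) (y₀ : BO)
    (h₀ : ∀ a b b' r, b ≠ y₀ → M ((a, (b, b')), r) ((a, (b, b')), r) = 0) :
    IsPure (applyOracle (sendRight e x₀) M) := by
  obtain ⟨ψ, h⟩ := h
  have hψ : ∀ a b b' r, b ≠ y₀ → ψ ((a, (b, b')), r) = 0 := by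
    intro a b b' r hb
    have := h₀ a b b' r hb
    rw [h] at this
    simpa using this
  refine ⟨fun p => if p.1.1.1 = x₀ then
    ψ (((e.symm p.1.2.1, p.1.1.2), (y₀, p.1.2.2)), p.2) else 0, fun p p' => ?_⟩
  simp only [applyOracle, TwoParty.sendRight, LinearMap.coe_mk, AddHom.coe_mk, Matrix.of_apply]
  by_cases h1 : p.1.1.1 = x₀ <;> by_cases h2 : p'.1.1.1 = x₀ <;> simp only [h1, h2, and_self,
    and_true, and_false, if_true, if_false, star_zero, mul_zero, zero_mul]
  rw [Finset.sum_eq_single y₀ (fun b _ hb => by rw [h, hψ _ _ _ _ hb, zero_mul]) (by simp), h]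

theorem IsPure.sendLeft {AO A' BO B' R : Type} [Fintype AO] [DecidableEq BO]
    {M : Op (((AO × A') × (BO × B')) × R)} (h : IsPure M)
    (e : AO ≃ BO) (x₀ : AO) (y₀ : BO)
    (h₀ : ∀ a a' b r, a ≠ x₀ → M (((a, a'), b), r) (((a, a'), b), r) = 0) :
    IsPure (applyOracle (sendLeft e y₀) M) := by
  obtain ⟨ψ, h⟩ := h
  have hψ : ∀ a a' b r, a ≠ x₀ → ψ (((a, a'), b), r) = 0 := by
    intro a a' b r ha
    have := h₀ a a' b r ha
    rw [h] at this
    simpa using this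
  refine ⟨fun p => if p.1.2.1 = y₀ then
    ψ (((x₀, p.1.1.2), (e p.1.1.1, p.1.2.2)), p.2) else 0, fun p p' => ?_⟩
  simp only [applyOracle, TwoParty.sendLeft, LinearMap.coe_mk, AddHom.coe_mk, Matrix.of_apply]
  by_cases h1 : p.1.2.1 = y₀ <;> by_cases h2 : p'.1.2.1 = y₀ <;> simp only [h1, h2, and_self,
    and_true, and_false, if_true, if_false, star_zero, mul_zero, zero_mul]
  rw [Finset.sum_eq_single x₀ (fun b _ hb => by rw [h, hψ _ _ _ _ hb, zero_mul]) (by simp), h]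

/-- If the partial trace over an environment of a positive operator has been reset, then so has the
operator. -/
theorem diag_eq_zero_of_applyA_eq {AO A B R : Type} [Fintype AO] [DecidableEq AO] {m e : ℕ}
    {T : SuperOp (AO × Fin (m * e)) (AO × Fin m)} (hT : IsEnvTrace T) {x₀ : AO}
    {M : Op (((AO × Fin (m * e)) × B) × R)} (hM : IsPure M) {Φ : SuperOp A (AO × Fin m)}
    {M' : Op ((A × B) × R)} (h : applyA T M = applyA (resetFst x₀ ∘ₗ Φ) M')
    (a : AO) (a' : Fin (m * e)) (b : B) (r : R) (ha : a ≠ x₀) :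
    M (((a, a'), b), r) (((a, a'), b), r) = 0 := by
  obtain ⟨ψ, hψ⟩ := hM
  obtain ⟨⟨k, j⟩, rfl⟩ := finProdFinEquiv.surjective a'
  have h1 := congrFun (congrFun h (((a, k), b), r)) (((a, k), b), r)
  simp only [applyA, Matrix.of_apply, hT _ _ _, LinearMap.comp_apply, resetFst,
    LinearMap.coe_mk, AddHom.coe_mk, ha, false_and, if_false] at h1
  refine (Finset.sum_eq_zero_iff_of_nonneg fun j _ => ?_).1 h1 j (Finset.mem_univ j)
  rw [hψ]
  exact mul_star_self_nonneg _

theorem diag_eq_zero_of_applyB_eq {BO A B R : Type} [Fintype BO] [DecidableEq BO] {m e : ℕ}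
    {T : SuperOp (BO × Fin (m * e)) (BO × Fin m)} (hT : IsEnvTrace T) {y₀ : BO}
    {M : Op ((A × (BO × Fin (m * e))) × R)} (hM : IsPure M) {Φ : SuperOp B (BO × Fin m)}
    {M' : Op ((A × B) × R)} (h : applyB T M = applyB (resetFst y₀ ∘ₗ Φ) M')
    (a : A) (b : BO) (b' : Fin (m * e)) (r : R) (hb : b ≠ y₀) :
    M ((a, (b, b')), r) ((a, (b, b')), r) = 0 := by
  obtain ⟨ψ, hψ⟩ := hM
  obtain ⟨⟨k, j⟩, rfl⟩ := finProdFinEquiv.surjective b'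
  have h1 := congrFun (congrFun h ((a, (b, k)), r)) ((a, (b, k)), r)
  simp only [applyB, Matrix.of_apply, hT _ _ _, LinearMap.comp_apply, resetFst,
    LinearMap.coe_mk, AddHom.coe_mk, hb, false_and, if_false] at h1
  refine (Finset.sum_eq_zero_iff_of_nonneg fun j _ => ?_).1 h1 j (Finset.mem_univ j)
  rw [hψ]
  exact mul_star_self_nonneg _

/-! ### Dilations and purified parties -/

/-- The isometry `Σ_l K l ⊗ |l⟩`, which stores the index of the Kraus operator in the
environment. -/
def dilation {X Y : Type} {k : ℕ} (e : ℕ) (K : Fin k → Matrix Y X ℂ) :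
    Matrix (Y × Fin (k * e)) (X × Fin e) ℂ :=
  Matrix.of fun p q => if (finProdFinEquiv.symm p.2).2 = q.2 then
    K (finProdFinEquiv.symm p.2).1 p.1 q.1 else 0

theorem dilation_apply {X Y : Type} {k e : ℕ} (K : Fin k → Matrix Y X ℂ) (y : Y) (x : X)
    (l : Fin k) (j j' : Fin e) :
    dilation e K (y, finProdFinEquiv (l, j)) (x, j') = if j = j' then K l y x else 0 := by
  simp only [dilation, Matrix.of_apply, Equiv.symm_apply_apply]

theorem dilation_isometry {X Y : Type} [DecidableEq X] [Fintype Y] {k : ℕ} (e : ℕ)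
    {K : Fin k → Matrix Y X ℂ} (hK : ∑ l, (K l).conjTranspose * K l = 1) :
    (dilation e K).conjTranspose * dilation e K = 1 := by
  ext ⟨x, j⟩ ⟨x', j'⟩
  have h := congrFun (congrFun hK x) x'
  simp only [Matrix.sum_apply, Matrix.mul_apply, Matrix.conjTranspose_apply] at h
  simp only [Matrix.mul_apply, Matrix.conjTranspose_apply, Fintype.sum_prod_type]
  simp only [← finProdFinEquiv.sum_comp, Fintype.sum_prod_type, dilation_apply,
    apply_ite star, star_zero, ite_mul, zero_mul, Finset.sum_ite_eq', Finset.mem_univ, if_true]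
  by_cases hj : j = j'
  · rw [Finset.sum_comm] at h
    simpa [hj, Matrix.one_apply] using h
  · simp [hj]

theorem traceSnd_dilation {X Y : Type} [Fintype X] [Fintype Y] {k e : ℕ}
    (K : Fin k → Matrix Y X ℂ) (N : Op (X × Fin e)) :
    traceSnd Y (Fin (k * e)) (conjMap (dilation e K) N) =
      ∑ l, conjMap (K l) (traceSnd X (Fin e) N) := by
  ext y y'
  simp only [traceSnd, LinearMap.coe_mk, AddHom.coe_mk, Matrix.of_apply, conjMap_entry,
    Matrix.sum_apply, ← finProdFinEquiv.sum_comp, Fintype.sum_prod_type, dilation_apply,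
    apply_ite star, star_zero, ite_mul, zero_mul, mul_ite, mul_zero, Finset.sum_ite_eq,
    Finset.mem_univ, if_true]
  refine Finset.sum_congr rfl fun l _ => ?_
  rw [Finset.sum_comm]
  refine Finset.sum_congr rfl fun x _ => ?_
  simp only [Finset.sum_ite_irrel, Finset.sum_const_zero, Finset.sum_ite_eq, Finset.mem_univ,
    if_true]
  rw [Finset.sum_comm]
  simp only [Finset.mul_sum, Finset.sum_mul]

theorem reindexOp_apply {X Y : Type} (e : Y ≃ X) (M : Op X) (y y' : Y) :
    reindexOp e M y y' = M (e y) (e y') := rfl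

theorem reindexOp_conjMap_submatrix {X Y X' Y' : Type} [Fintype X] [Fintype X']
    (V : Matrix Y X ℂ) (s : Y' ≃ Y) (t : X' ≃ X) (N : Op X') :
    reindexOp s.symm (conjMap (V.submatrix s t) N) = conjMap V (reindexOp t.symm N) := by
  ext y y'
  rw [reindexOp_apply]
  simp only [conjMap_entry, Matrix.submatrix_apply, reindexOp_apply, Equiv.apply_symm_apply]
  rw [← t.sum_comp]
  refine Finset.sum_congr rfl fun x _ => ?_
  rw [← t.sum_comp]
  simp only [Equiv.symm_apply_apply]

theorem submatrix_isometry {X Y X' Y' : Type} [DecidableEq X] [DecidableEq X']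
    [Fintype Y] [Fintype Y'] {V : Matrix Y X ℂ} (hV : V.conjTranspose * V = 1)
    (s : Y' ≃ Y) (t : X' ≃ X) :
    (V.submatrix s t).conjTranspose * V.submatrix s t = 1 := by
  rw [Matrix.conjTranspose_submatrix, Matrix.submatrix_mul_equiv, hV, Matrix.submatrix_one_equiv]

/-- A party which performs the operations `Ψ i` coherently, with isometries `V i` instead of
quantum operations, and keeps the environments; `T i` discards them. -/
structure Purification {n d : ℕ} {o : ℕ → ℕ} (P : Party n d o)
    (Ψ : ∀ i, SuperOp (P.Space i) (P.Space (i + 1))) where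
  env : ℕ → ℕ
  V : ∀ i, Matrix (Reg d o (fun i => P.mem i * env i) (i + 1))
    (Reg d o (fun i => P.mem i * env i) i) ℂ
  T : ∀ i, SuperOp (Reg d o (fun i => P.mem i * env i) i) (P.Space i)
  isometry : ∀ i < n, (V i).conjTranspose * V i = 1
  isQuantumOp_T : ∀ i, IsQuantumOp (T i)
  T_zero : T 0 = LinearMap.id
  T_succ : ∀ i, IsEnvTrace (O := Fin (o i)) (m := P.mem i) (e := env i) (T (i + 1))
  T_comp : ∀ i < n, T (i + 1) ∘ₗ conjMap (V i) = Ψ i ∘ₗ T i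

/-- The total dimension of the environments up to time `i`. -/
def envDim (k : ℕ → ℕ) : ℕ → ℕ
  | 0 => 1
  | i + 1 => k i * envDim k i

/-- The register of a purified party consists of the honest register and the environment. -/
def splitEnv (d : ℕ) (o m k : ℕ → ℕ) : ∀ i,
    Reg d o (fun i => m i * envDim k (i + 1)) i ≃ Reg d o m i × Fin (envDim k i)
  | 0 => (Equiv.prodUnique (Fin d) (Fin 1)).symm
  | i + 1 => ((Equiv.refl (Fin (o i))).prodCongr finProdFinEquiv.symm).trans
      (Equiv.prodAssoc (Fin (o i)) (Fin (m i)) (Fin (envDim k (i + 1)))).symm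

theorem nonempty_purification {n d : ℕ} {o : ℕ → ℕ} (P : Party n d o)
    (Ψ : ∀ i, SuperOp (P.Space i) (P.Space (i + 1))) (hΨ : ∀ i < n, IsQuantumOp (Ψ i)) :
    Nonempty (Purification P Ψ) := by
  have hK : ∀ i, ∃ (k : ℕ) (K : Fin k → Matrix (P.Space (i + 1)) (P.Space i) ℂ), i < n →
      (∀ M, Ψ i M = ∑ j, conjMap (K j) M) ∧ ∑ j, (K j).conjTranspose * K j = 1 := by
    intro i
    by_cases hi : i < n
    · obtain ⟨k, K, h⟩ := (hΨ i hi).exists_kraus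
      exact ⟨k, K, fun _ => h⟩
    · exact ⟨0, Fin.elim0, fun h => absurd h hi⟩
  choose k K hK using hK
  let s := splitEnv d o P.mem k
  -- Memory entry `i` belongs to the register at time `i + 1`, hence the shift.
  refine ⟨{ env := fun i => envDim k (i + 1)
            V := fun i => (dilation (envDim k i) (K i)).submatrix (s (i + 1)) (s i)
            T := fun i => traceSnd _ (Fin (envDim k i)) ∘ₗ reindexOp (s i).symm
            isometry := fun i hi => ?_
            isQuantumOp_T := fun i => (isQuantumOp_traceSnd _ _).comp (isQuantumOp_reindexOp _)
            T_zero := ?_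
            T_succ := fun i N p p' => rfl
            T_comp := fun i hi => ?_ }⟩
  · exact submatrix_isometry (dilation_isometry (envDim k i) (hK i hi).2) (s (i + 1)) (s i)
  · refine LinearMap.ext fun N => ?_
    ext p p'
    exact Fin.sum_univ_one fun j : Fin 1 => N ((s 0).symm (p, j)) ((s 0).symm (p', j))
  · refine LinearMap.ext fun N => ?_
    have h1 := reindexOp_conjMap_submatrix (dilation (envDim k i) (K i)) (s (i + 1)) (s i) N
    have h2 := traceSnd_dilation (K i) (reindexOp (s i).symm N)
    exact (congrArg (traceSnd _ _) h1).trans (h2.trans ((hK i hi).1 _).symm)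

/-- The party described by a purification. -/
def Purification.party {n d : ℕ} {o : ℕ → ℕ} {P : Party n d o}
    {Ψ : ∀ i, SuperOp (P.Space i) (P.Space (i + 1))} (Q : Purification P Ψ) : Party n d o where
  mem := fun i => P.mem i * Q.env i
  op := fun i => conjMap (Q.V i)
  isOp := fun i hi => isQuantumOp_conjMap (Q.isometry i hi)

/-! ### Purified strategies in the bare model -/

/-- Discarding the environment commutes with the oracle and with Bob, and turns the isometry into Ψ,
which the oracle cannot tell from the honest operation. -/
theorem applyA_step {AO A B BO B' A₁ R : Type} [Fintype AO] [Fintype BO] [Fintype A]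
    [Fintype A₁] [Fintype B] {k e : ℕ} {T' : SuperOp (AO × Fin (k * e)) (AO × Fin k)}
    (hT' : IsEnvTrace T') {C : SuperOp A₁ (AO × Fin (k * e))} {T : SuperOp A₁ A}
    {Ψ op : SuperOp A (AO × Fin k)} (h : T' ∘ₗ C = Ψ ∘ₗ T) (Φ : SuperOp B (BO × B'))
    {O : SuperOp (AO × BO) (AO × BO)}
    (hΨ : ∀ M : Op ((A × (BO × B')) × R),
      applyOracle O (applyA Ψ M) = applyOracle O (applyA op M))
    {σ : Op ((A₁ × B) × R)} {σ' : Op ((A × B) × R)} (hσ : applyA T σ = σ') :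
    applyA T' (applyOracle O (applyB Φ (applyA C σ))) =
      applyOracle O (applyB Φ (applyA op σ')) := by
  have h' : applyA T' (applyA C (applyB Φ σ)) = applyA Ψ (applyA T (applyB Φ σ)) :=
    congrArg (fun F => applyA F (applyB Φ σ)) h
  rw [applyA_applyOracle_comm hT', applyA_applyB_comm C, h', hΨ, ← applyA_applyB_comm T, hσ,
    applyA_applyB_comm]

theorem applyB_step {BO A B AO A' B₁ R : Type} [Fintype AO] [Fintype BO] [Fintype A]
    [Fintype B₁] [Fintype B] {k e : ℕ} {T' : SuperOp (BO × Fin (k * e)) (BO × Fin k)}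
    (hT' : IsEnvTrace T') {C : SuperOp B₁ (BO × Fin (k * e))} {T : SuperOp B₁ B}
    {Ψ op : SuperOp B (BO × Fin k)} (h : T' ∘ₗ C = Ψ ∘ₗ T) (Φ : SuperOp A (AO × A'))
    {O : SuperOp (AO × BO) (AO × BO)}
    (hΨ : ∀ M : Op (((AO × A') × B) × R),
      applyOracle O (applyB Ψ M) = applyOracle O (applyB op M))
    {σ : Op ((A × B₁) × R)} {σ' : Op ((A × B) × R)} (hσ : applyB T σ = σ') :
    applyB T' (applyOracle O (applyB C (applyA Φ σ))) =
      applyOracle O (applyB op (applyA Φ σ')) := by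
  have h' : applyB T' (applyB C (applyA Φ σ)) = applyB Ψ (applyB T (applyA Φ σ)) :=
    congrArg (fun F => applyB F (applyA Φ σ)) h
  rw [applyB_applyOracle_comm hT', h', hΨ, applyA_applyB_comm Φ T, hσ]

namespace Strategy

variable {n dA dB : ℕ} {R : Type}

theorem applyA_state_withAlice (S : Strategy n dA dB)
    {Ψ : ∀ i, SuperOp (S.alice.Space i) (S.alice.Space (i + 1))} (Q : Purification S.alice Ψ)
    (hΨ : ∀ i < n, ∀ M : Op ((S.alice.Space i × S.bob.Space (i + 1)) × R),
      applyOracle (S.oracle i) (applyA (Ψ i) M) =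
        applyOracle (S.oracle i) (applyA (S.alice.op i) M))
    (ρ : Op ((Fin dA × Fin dB) × R)) (i : ℕ) (hi : i ≤ n) :
    applyA (Q.T i) ((S.withAlice Q.party).state ρ i) = S.state ρ i := by
  induction i with
  | zero => rw [Q.T_zero]; rfl
  | succ i ih =>
    exact applyA_step (Q.T_succ i) (Q.T_comp i hi) (S.bob.op i) (hΨ i hi)
      (ih (Nat.le_of_succ_le hi))

theorem applyB_state_withBob (S : Strategy n dA dB)
    {Ψ : ∀ i, SuperOp (S.bob.Space i) (S.bob.Space (i + 1))} (Q : Purification S.bob Ψ)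
    (hΨ : ∀ i < n, ∀ M : Op ((S.alice.Space (i + 1) × S.bob.Space i) × R),
      applyOracle (S.oracle i) (applyB (Ψ i) M) =
        applyOracle (S.oracle i) (applyB (S.bob.op i) M))
    (ρ : Op ((Fin dA × Fin dB) × R)) (i : ℕ) (hi : i ≤ n) :
    applyB (Q.T i) ((S.withBob Q.party).state ρ i) = S.state ρ i := by
  induction i with
  | zero => rw [Q.T_zero]; rfl
  | succ i ih =>
    exact applyB_step (Q.T_succ i) (Q.T_comp i hi) (S.alice.op i) (hΨ i hi)
      (ih (Nat.le_of_succ_le hi))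

end Strategy

/-- Operations `Ψ`, `Ψ'` of the two parties, equivalent to `Φ`, `Φ'` when followed by the oracle
`O`, for which coherent versions followed by `O` preserve pure states. -/
structure IsEffective {a b k l : ℕ} {A B : Type} [Fintype A] [Fintype B]
    (O : SuperOp (Fin a × Fin b) (Fin a × Fin b))
    (Φ Ψ : SuperOp A (Fin a × Fin k)) (Φ' Ψ' : SuperOp B (Fin b × Fin l)) : Prop where
  isQuantumOp_left : IsQuantumOp Ψ
  isQuantumOp_right : IsQuantumOp Ψ'
  left : ∀ (B' R : Type) (M : Op ((A × (Fin b × B')) × R)),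
    applyOracle O (applyA Ψ M) = applyOracle O (applyA Φ M)
  right : ∀ (A' R : Type) (M : Op (((Fin a × A') × B) × R)),
    applyOracle O (applyB Ψ' M) = applyOracle O (applyB Φ' M)
  pure : ∀ (e f : ℕ) (T : SuperOp (Fin a × Fin (k * e)) (Fin a × Fin k))
    (T' : SuperOp (Fin b × Fin (l * f)) (Fin b × Fin l)) (R : Type)
    (M : Op (((Fin a × Fin (k * e)) × (Fin b × Fin (l * f))) × R)),
    IsEnvTrace T → IsEnvTrace T' → IsPure M →
    (∃ N, applyA T M = applyA Ψ N) → (∃ N, applyB T' M = applyB Ψ' N) →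
    IsPure (applyOracle O M)

theorem IsCommunication.exists_isEffective {a b k l : ℕ} {A B : Type} [Fintype A] [Fintype B]
    {O : SuperOp (Fin a × Fin b) (Fin a × Fin b)} (hO : IsCommunication O)
    {Φ : SuperOp A (Fin a × Fin k)} {Φ' : SuperOp B (Fin b × Fin l)}
    (hΦ : IsQuantumOp Φ) (hΦ' : IsQuantumOp Φ') : ∃ Ψ Ψ', IsEffective O Φ Ψ Φ' Ψ' := by
  rcases hO with ⟨e, x₀, rfl⟩ | ⟨e, y₀, rfl⟩
  -- Only the receiver is modified; `e x₀` is merely some basis state of its register.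
  · refine ⟨Φ, resetFst (e x₀) ∘ₗ Φ', hΦ, (isQuantumOp_resetFst _).comp hΦ', fun _ _ _ => rfl,
      fun A' R M => applyOracle_sendRight_resetFst e x₀ (e x₀) (applyB Φ' M), ?_⟩
    rintro e₁ f T T' R M hT hT' hM - ⟨N, hN⟩
    exact hM.sendRight e x₀ (e x₀) fun p b b' r hb =>
      diag_eq_zero_of_applyB_eq hT' hM hN p b b' r hb
  · refine ⟨resetFst (e.symm y₀) ∘ₗ Φ, Φ', (isQuantumOp_resetFst _).comp hΦ, hΦ',
      fun B' R M => applyOracle_sendLeft_resetFst e (e.symm y₀) y₀ (applyA Φ M),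
      fun _ _ _ => rfl, ?_⟩
    rintro e₁ f T T' R M hT hT' hM ⟨N, hN⟩ -
    exact hM.sendLeft e (e.symm y₀) y₀ fun p b b' r hb =>
      diag_eq_zero_of_applyA_eq hT hM hN p b b' r hb

theorem isPure_step {a b k l e f : ℕ} {A B A₁ B₁ R : Type} [Fintype A] [Fintype B]
    [Fintype A₁] [Fintype B₁] {O : SuperOp (Fin a × Fin b) (Fin a × Fin b)}
    {Φ Ψ : SuperOp A (Fin a × Fin k)} {Φ' Ψ' : SuperOp B (Fin b × Fin l)}
    (h : IsEffective O Φ Ψ Φ' Ψ')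
    {T' : SuperOp (Fin a × Fin (k * e)) (Fin a × Fin k)} (hT' : IsEnvTrace T')
    {U' : SuperOp (Fin b × Fin (l * f)) (Fin b × Fin l)} (hU' : IsEnvTrace U')
    {V : Matrix (Fin a × Fin (k * e)) A₁ ℂ} {W : Matrix (Fin b × Fin (l * f)) B₁ ℂ}
    {T : SuperOp A₁ A} {U : SuperOp B₁ B}
    (hV : T' ∘ₗ conjMap V = Ψ ∘ₗ T) (hW : U' ∘ₗ conjMap W = Ψ' ∘ₗ U)
    {σ : Op ((A₁ × B₁) × R)} (hσ : IsPure σ) :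
    IsPure (applyOracle O (applyB (conjMap W) (applyA (conjMap V) σ))) := by
  refine h.pure _ _ T' U' R _ hT' hU' ((hσ.applyA V).applyB W) ⟨applyA T (applyB (conjMap W) σ), ?_⟩
    ⟨applyB U (applyA (conjMap V) σ), ?_⟩
  · rw [applyA_applyB_comm]
    exact congrArg (fun F => applyA F (applyB (conjMap W) σ)) hV
  · exact congrArg (fun F => applyB F (applyA (conjMap V) σ)) hW

namespace Strategy

variable {n dA dB : ℕ}

/-- In the bare model both parties can be purified, such that the honest view of each of them
is obtained by discarding environments, and the joint state of the two purified parties is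
pure. -/
theorem IsBare.exists_purification {S : Strategy n dA dB} (hS : S.IsBare) :
    ∃ (A' : Party n dA S.oA) (B' : Party n dB S.oB)
      (T : ∀ i, SuperOp (A'.Space i) (S.alice.Space i))
      (U : ∀ i, SuperOp (B'.Space i) (S.bob.Space i)),
      (∀ i, IsQuantumOp (T i)) ∧ (∀ i, IsQuantumOp (U i)) ∧
      ∀ (R : Type) (ρ : Op ((Fin dA × Fin dB) × R)), ∀ i ≤ n,
        applyA (T i) ((S.withAlice A').state ρ i) = S.state ρ i ∧
        applyB (U i) ((S.withBob B').state ρ i) = S.state ρ i ∧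
        applyA (T i) (((S.withAlice A').withBob B').state ρ i) = (S.withBob B').state ρ i ∧
        applyB (U i) (((S.withAlice A').withBob B').state ρ i) = (S.withAlice A').state ρ i ∧
        (IsPure ρ → IsPure (((S.withAlice A').withBob B').state ρ i)) := by
  have h : ∀ i, ∃ (Ψ : SuperOp (S.alice.Space i) (S.alice.Space (i + 1)))
      (Ψ' : SuperOp (S.bob.Space i) (S.bob.Space (i + 1))), i < n →
      IsEffective (k := S.alice.mem i) (l := S.bob.mem i) (S.oracle i) (S.alice.op i) Ψ
        (S.bob.op i) Ψ' := by
    intro i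
    by_cases hi : i < n
    · obtain ⟨Ψ, Ψ', h⟩ := IsCommunication.exists_isEffective (k := S.alice.mem i)
        (l := S.bob.mem i) (hS i hi) (S.alice.isOp i hi) (S.bob.isOp i hi)
      exact ⟨Ψ, Ψ', fun _ => h⟩
    · exact ⟨0, 0, fun h => absurd h hi⟩
  choose Ψ Ψ' h using h
  obtain ⟨Q⟩ := nonempty_purification S.alice Ψ fun i hi => (h i hi).isQuantumOp_left
  obtain ⟨Q'⟩ := nonempty_purification S.bob Ψ' fun i hi => (h i hi).isQuantumOp_right
  refine ⟨Q.party, Q'.party, Q.T, Q'.T, Q.isQuantumOp_T, Q'.isQuantumOp_T,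
    fun R ρ i hi => ⟨?_, ?_, ?_, ?_, fun hρ => ?_⟩⟩
  · exact S.applyA_state_withAlice Q (fun i hi => (h i hi).left _ R) ρ i hi
  · exact S.applyB_state_withBob Q' (fun i hi => (h i hi).right _ R) ρ i hi
  · exact (S.withBob Q'.party).applyA_state_withAlice Q (fun i hi => (h i hi).left _ R) ρ i hi
  · exact (S.withAlice Q.party).applyB_state_withBob Q' (fun i hi => (h i hi).right _ R) ρ i hi
  · induction i with
    | zero => exact hρ
    | succ i ih =>
      exact isPure_step (h i hi) (Q.T_succ i) (Q'.T_succ i) (Q.T_comp i hi) (Q'.T_comp i hi)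
        (ih (Nat.le_of_succ_le hi))

end Strategy

/-! ### Positivity and traces of reduced operators -/

theorem traceDist_le_of_eq {X : Type} [Fintype X] [DecidableEq X] {M N : Op X} (h : M = N)
    {ε : ℝ} (hε : 0 ≤ ε) : traceDist M N ≤ ε := by
  rwa [h, traceDist_self]

theorem traceOutB_posSemidef {A B R : Type} [Fintype A] [Fintype B] [Fintype R]
    {M : Op ((A × B) × R)} (hM : M.PosSemidef) : (traceOutB M).PosSemidef := by
  have : traceOutB M =
      ∑ b, M.submatrix (fun p : A × R => ((p.1, b), p.2)) fun p => ((p.1, b), p.2) := by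
    ext; simp [traceOutB, Matrix.sum_apply]
  rw [this]
  exact Matrix.posSemidef_sum _ fun b _ => hM.submatrix _

theorem traceOutA_posSemidef {A B R : Type} [Fintype A] [Fintype B] [Fintype R]
    {M : Op ((A × B) × R)} (hM : M.PosSemidef) : (traceOutA M).PosSemidef := by
  have : traceOutA M =
      ∑ a, M.submatrix (fun p : B × R => ((a, p.1), p.2)) fun p => ((a, p.1), p.2) := by
    ext; simp [traceOutA, Matrix.sum_apply]
  rw [this]
  exact Matrix.posSemidef_sum _ fun b _ => hM.submatrix _

theorem traceOutB_trace {A B R : Type} [Fintype A] [Fintype B] [Fintype R]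
    (M : Op ((A × B) × R)) : (traceOutB M).trace = M.trace := by
  simp only [traceOutB, Matrix.trace, Matrix.diag_apply, Matrix.of_apply,
    Fintype.sum_prod_type]
  exact Finset.sum_congr rfl fun _ _ => Finset.sum_comm

theorem IsQuantumOp.applyA_posSemidef {A A' B R : Type} [Fintype A] [Fintype A'] [Fintype B]
    [Fintype R] {Φ : SuperOp A A'} (h : IsQuantumOp Φ) {M : Op ((A × B) × R)}
    (hM : M.PosSemidef) : (applyA Φ M).PosSemidef :=
  (h.tensorId_posSemidef (hM.submatrix fun p : A × (B × R) => ((p.1, p.2.1), p.2.2))).submatrix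
    fun p : (A' × B) × R => (p.1.1, (p.1.2, p.2))

theorem IsQuantumOp.applyB_posSemidef {A B B' R : Type} [Fintype A] [Fintype B] [Fintype B']
    [Fintype R] {Φ : SuperOp B B'} (h : IsQuantumOp Φ) {M : Op ((A × B) × R)}
    (hM : M.PosSemidef) : (applyB Φ M).PosSemidef :=
  (h.tensorId_posSemidef (hM.submatrix fun p : B × (A × R) => ((p.2.1, p.1), p.2.2))).submatrix
    fun p : (A × B') × R => (p.1.2, (p.1.1, p.2))

/-! ### Decoupling from a reference qubit -/

/-- The operator `ν ⊗ 𝟙`, for the decomposition `f` of `R` into two qubits. -/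
def tensorOne {X R : Type} (f : R ≃ Fin 2 × Fin 2) (ν : Op (X × Fin 2)) : Op (X × R) :=
  Matrix.of fun p p' =>
    if (f p.2).2 = (f p'.2).2 then ν (p.1, (f p.2).1) (p'.1, (f p'.2).1) else 0

/-- Up to `c` in trace norm, `V` is the tensor product of a state and the maximally mixed state of
the second qubit of `R`. -/
def IsDecoupled {X R : Type} [Fintype X] [Fintype R] (f : R ≃ Fin 2 × Fin 2) (c : ℝ)
    (V : Op (X × R)) : Prop :=
  ∃ ν : Op (X × Fin 2), ν.trace = 1 / 2 ∧ HermBound (V - tensorOne f ν) c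

theorem tensorId_tensorOne {X Y R : Type} (Φ : SuperOp X Y) (f : R ≃ Fin 2 × Fin 2)
    (ν : Op (X × Fin 2)) : tensorId R Φ (tensorOne f ν) = tensorOne f (tensorId (Fin 2) Φ ν) := by
  ext p p'
  simp only [tensorId, tensorOne, Matrix.of_apply]
  split_ifs
  · rfl
  · exact congrFun (congrFun (map_zero Φ) p.1) p'.1

theorem tensorId_sub {X Y Z : Type} (Φ : SuperOp X Y) (M N : Op (X × Z)) :
    tensorId Z Φ (M - N) = tensorId Z Φ M - tensorId Z Φ N := by
  ext p p'
  exact congrFun (congrFun (map_sub Φ (Matrix.of fun x x' => M (x, p.2) (x', p'.2))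
    (Matrix.of fun x x' => N (x, p.2) (x', p'.2))) p.1) p'.1

/-- An operation on `X` acts on ν alone and leaves the maximally mixed qubit in place; the error
does not grow. -/
theorem IsDecoupled.tensorId {X Y R : Type} [Fintype X] [Fintype Y] [Fintype R]
    {f : R ≃ Fin 2 × Fin 2} {c : ℝ} {V : Op (X × R)} (h : IsDecoupled f c V)
    {Φ : SuperOp X Y} (hΦ : IsQuantumOp Φ) : IsDecoupled f c (tensorId R Φ V) := by
  obtain ⟨ν, hν, h⟩ := h
  refine ⟨TwoParty.tensorId (Fin 2) Φ ν, by rw [hΦ.tensorId_trace, hν], ?_⟩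
  rw [← tensorId_tensorOne, ← tensorId_sub]
  exact h.map _ (tensorId_sub Φ) (fun _ => hΦ.tensorId_posSemidef) hΦ.tensorId_trace

/-- Monogamy: a qubit of the reference system cannot be decoupled from both parties if the joint
state is pure. -/
theorem IsPure.one_le_of_isDecoupled {A B R : Type} [Fintype A] [Fintype B] [Fintype R]
    {M : Op ((A × B) × R)} (hM : IsPure M) {f : R ≃ Fin 2 × Fin 2} {c : ℝ}
    (hB : IsDecoupled f c (traceOutB M)) (hA : IsDecoupled f c (traceOutA M)) : 1 ≤ 4 * c := by
  obtain ⟨ψ, hψ⟩ := hM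
  obtain ⟨ν, hν, P, N, hP, hN, hPN, hc⟩ := hB
  obtain ⟨ν', -, P', N', hP', hN', hPN', hc'⟩ := hA
  have hV : ∀ p p', traceOutB M p p' = tensorOne f ν p p' + (P p p' - N p p') := by
    intro p p'
    have := congrFun (congrFun hPN p) p'
    simp only [Matrix.sub_apply] at this
    rw [← this]; ring
  have hV' : ∀ p p', traceOutA M p p' = tensorOne f ν' p p' + (P' p p' - N' p p') := by
    intro p p'
    have := congrFun (congrFun hPN' p) p'
    simp only [Matrix.sub_apply] at this
    rw [← this]; ring
  -- The vector is cut along the decoupled qubit `r`; the other reference qubit is given to Alice.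
  let m : Fin 2 → Matrix (A × Fin 2) B ℂ := fun r =>
    Matrix.of fun x b => ψ ((x.1, b), f.symm (x.2, r))
  let g : Fin 2 → A × Fin 2 → A × R := fun r x => (x.1, f.symm (x.2, r))
  let blk : Op (A × R) → Fin 2 → Op (A × Fin 2) := fun L r => L.submatrix (g r) (g r)
  -- The other reference qubit is traced out. The transpose matches (m r)† (m s), in which the first
  -- index carries the conjugate.
  let red : Op (B × R) → Op (B × Fin 2) := fun L =>
    (∑ k, L.submatrix (fun p => (p.1, f.symm (k, p.2))) fun p => (p.1, f.symm (k, p.2))).transpose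
  have hm : ∀ r, m r * (m r).conjTranspose = ν + (blk P r - blk N r) := by
    intro r
    ext x x'
    have := hV (g r x) (g r x')
    simp only [traceOutB, tensorOne, Matrix.of_apply, g, Equiv.apply_symm_apply, if_true, hψ]
      at this
    simpa [Matrix.mul_apply, m, blk, g] using this
  have hsum : ∀ L : Op (A × R), (blk L 0).trace + (blk L 1).trace = L.trace := by
    intro L
    simp only [blk, g, Matrix.trace, Matrix.diag_apply, Matrix.submatrix_apply,
      Fintype.sum_prod_type]
    simp only [← f.symm.sum_comp, Fintype.sum_prod_type, ← Finset.sum_add_distrib,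
      Fin.sum_univ_two]
    exact Finset.sum_congr rfl fun _ _ => by ring
  have hred : ∀ L : Op (B × R), (red L).trace = L.trace := by
    intro L
    simp only [red, Matrix.trace_transpose, Matrix.trace_sum]
    simp only [Matrix.trace, Matrix.diag_apply, Matrix.submatrix_apply, Fintype.sum_prod_type]
    simp only [← f.symm.sum_comp, Fintype.sum_prod_type]
    exact Finset.sum_comm
  have hredpos : ∀ L : Op (B × R), L.PosSemidef → (red L).PosSemidef := fun L hL =>
    (Matrix.posSemidef_sum _ fun k _ => hL.submatrix _).transpose
  have hD : m 0 * (m 0).conjTranspose - m 1 * (m 1).conjTranspose =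
      (blk P 0 + blk N 1) - (blk P 1 + blk N 0) := by
    rw [hm, hm]; abel
  have key := trace_le_of_blocks m ((hP.submatrix (g 0)).add (hN.submatrix (g 1)))
    ((hP.submatrix (g 1)).add (hN.submatrix (g 0))) hD (hredpos P' hP') (hredpos N' hN') (by
      intro r s hrs
      ext b b'
      have h1 : ∀ k, traceOutA M (b', f.symm (k, s)) (b, f.symm (k, r)) =
          P' (b', f.symm (k, s)) (b, f.symm (k, r)) -
            N' (b', f.symm (k, s)) (b, f.symm (k, r)) := by
        intro k
        rw [hV']
        simp [tensorOne, hrs.symm]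
      simp only [traceOutA, Matrix.of_apply, hψ] at h1
      simp only [red, Matrix.transpose_apply, Matrix.sum_apply, Matrix.submatrix_apply,
        Matrix.of_apply, ← Finset.sum_sub_distrib, ← h1]
      simp only [m, Matrix.mul_apply, Matrix.conjTranspose_apply, Matrix.of_apply,
        Fintype.sum_prod_type]
      rw [Finset.sum_comm]
      exact Finset.sum_congr rfl fun _ _ => Finset.sum_congr rfl fun _ _ => mul_comm _ _)
  -- The left side is 1 + tr P - tr N, so 1 ≤ tr P' + tr N' + tr P + 3 tr N, which is at most 4c.
  rw [hred, hred, hm, hm] at key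
  have hP1 := congrArg Complex.re (hsum P)
  have hN1 := congrArg Complex.re (hsum N)
  have hν1 := congrArg Complex.re hν
  simp only [blk, g, Matrix.trace_add, Matrix.trace_sub, Complex.add_re, Complex.sub_re] at *
  norm_num at hν1
  have hPnn := (Complex.le_def.1 hP.trace_nonneg).1
  have hNnn := (Complex.le_def.1 hN.trace_nonneg).1
  simp only [Complex.zero_re] at hPnn hNnn
  linarith

/-! ### The maximally entangled input -/

/-- The maximally entangled state of the inputs and the reference system. -/
def maxEntangled : InputOp 2 2 :=
  Matrix.of fun p p' => (if p.1 = p.2 then 1 / 2 else 0) * (if p'.1 = p'.2 then 1 / 2 else 0)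

/-- The maximally entangled state of two qubits, of trace `1 / 2`. -/
def bellHalf : Op (Fin 2 × Fin 2) :=
  Matrix.of fun p p' => (if p.1 = p.2 then 1 / 2 else 0) * (if p'.1 = p'.2 then 1 / 2 else 0)

theorem bellHalf_trace : bellHalf.trace = 1 / 2 := by
  simp [bellHalf, Matrix.trace, Fintype.sum_prod_type]

theorem isPure_maxEntangled : IsPure maxEntangled :=
  ⟨fun p => if p.1 = p.2 then 1 / 2 else 0, fun p p' => by
    simp [maxEntangled, apply_ite (starRingEnd ℂ), Complex.conj_ofNat]⟩

theorem isState_maxEntangled : IsState maxEntangled :=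
  ⟨isPure_maxEntangled.posSemidef, by
    simp [maxEntangled, Matrix.trace, Fintype.sum_prod_type]
    norm_num⟩

theorem applyU_swapGate (ρ : InputOp 2 2) (p p' : (Fin 2 × Fin 2) × Ref 2 2) :
    applyU swapGate.1 ρ p p' = ρ (p.1.swap, p.2) (p'.1.swap, p'.2) := by
  have hU : swapGate.1 ⊗ₖ (1 : Matrix (Ref 2 2) (Ref 2 2) ℂ) =
      Matrix.of fun p q => if (p.1.swap, p.2) = q then 1 else 0 := by
    ext ⟨a, r⟩ ⟨b, s⟩
    have : a = b.swap ↔ a.swap = b := by rw [← Prod.swap_inj, Prod.swap_swap]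
    by_cases h : a.swap = b <;> by_cases h' : r = s <;>
      simp [swapGate, this, h, h']
  rw [applyU, hU]
  simp [Matrix.mul_apply, apply_ite (starRingEnd ℂ)]

theorem traceOutB_maxEntangled :
    traceOutB maxEntangled = tensorOne (Equiv.refl _) bellHalf := by
  ext ⟨a, r, s⟩ ⟨a', r', s'⟩
  fin_cases s <;> fin_cases s' <;>
    simp [traceOutB, maxEntangled, tensorOne, bellHalf, Fin.sum_univ_two]

theorem traceOutA_maxEntangled :
    traceOutA maxEntangled = tensorOne (Equiv.prodComm _ _) bellHalf := by
  ext ⟨a, r, s⟩ ⟨a', r', s'⟩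
  fin_cases r <;> fin_cases r' <;>
    simp [traceOutA, maxEntangled, tensorOne, bellHalf, Fin.sum_univ_two]

theorem traceOutB_applyU_maxEntangled :
    traceOutB (applyU swapGate.1 maxEntangled) = tensorOne (Equiv.prodComm _ _) bellHalf := by
  ext ⟨a, r, s⟩ ⟨a', r', s'⟩
  fin_cases r <;> fin_cases r' <;>
    simp [traceOutB, applyU_swapGate, maxEntangled, tensorOne, bellHalf, Fin.sum_univ_two]

theorem traceOutA_applyU_maxEntangled :
    traceOutA (applyU swapGate.1 maxEntangled) = tensorOne (Equiv.refl _) bellHalf := by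
  ext ⟨a, r, s⟩ ⟨a', r', s'⟩
  fin_cases s <;> fin_cases s' <;>
    simp [traceOutA, applyU_swapGate, maxEntangled, tensorOne, bellHalf, Fin.sum_univ_two]

/-- A simulator acts on one half of a Bell pair only, so the simulated view is exactly decoupled;
the factor 2 undoes the ½ in the trace distance. -/
theorem isDecoupled_of_traceDist_le {X : Type} [Fintype X] [DecidableEq X]
    {f : Ref 2 2 ≃ Fin 2 × Fin 2} {Φ : SuperOp (Fin 2) X} (hΦ : IsQuantumOp Φ)
    {W : Op (Fin 2 × Ref 2 2)} (hW : W.PosSemidef) (hWf : W = tensorOne f bellHalf)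
    {V V₁ V₂ : Op (X × Ref 2 2)} (hV : V.PosSemidef) {δ : ℝ} (h : traceDist V₁ V₂ ≤ δ)
    (h₁ : V₁ = tensorId (Ref 2 2) Φ W) (h₂ : V₂ = V) : IsDecoupled f (2 * δ) V := by
  subst h₁ h₂
  refine ⟨tensorId (Fin 2) Φ bellHalf, by rw [hΦ.tensorId_trace, bellHalf_trace], ?_⟩
  rw [← tensorId_tensorOne, ← hWf]
  exact (HermBound.of_traceDist_le (hΦ.tensorId_posSemidef hW) hV h).neg

/-! ### Persistence of decoupling for the sender -/

theorem Strategy.isDecoupled_traceOutB_succ {n dA dB : ℕ} (S : Strategy n dA dB) {i : ℕ}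
    (hi : i < n) {R : Type} [Fintype R] {f : R ≃ Fin 2 × Fin 2} {c : ℝ}
    {ρ : Op ((Fin dA × Fin dB) × R)} (h : IsDecoupled f c (traceOutB (S.state ρ i)))
    {e : Fin (S.oA i) ≃ Fin (S.oB i)} {x₀ : Fin (S.oA i)} (hO : S.oracle i = sendRight e x₀) :
    IsDecoupled f c (traceOutB (S.state ρ (i + 1))) := by
  have key := (h.tensorId (S.alice.isOp i hi)).tensorId
    (isQuantumOp_resetFst (O := Fin (S.oA i)) (M := Fin (S.alice.mem i)) x₀)
  rw [← traceOutB_applyA, ← traceOutB_applyB (S.bob.isOp i hi).2] at key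
  have h1 := traceOutB_applyOracle_sendRight (A' := Fin (S.alice.mem i))
    (B' := Fin (S.bob.mem i)) e x₀ (applyB (S.bob.op i) (applyA (S.alice.op i) (S.state ρ i)))
  rw [← hO] at h1
  exact h1 ▸ key

theorem Strategy.isDecoupled_traceOutA_succ {n dA dB : ℕ} (S : Strategy n dA dB) {i : ℕ}
    (hi : i < n) {R : Type} [Fintype R] {f : R ≃ Fin 2 × Fin 2} {c : ℝ}
    {ρ : Op ((Fin dA × Fin dB) × R)} (h : IsDecoupled f c (traceOutA (S.state ρ i)))
    {e : Fin (S.oA i) ≃ Fin (S.oB i)} {y₀ : Fin (S.oB i)} (hO : S.oracle i = sendLeft e y₀) :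
    IsDecoupled f c (traceOutA (S.state ρ (i + 1))) := by
  rw [← traceOutA_applyA (S.alice.isOp i hi).2] at h
  have key := (h.tensorId (S.bob.isOp i hi)).tensorId
    (isQuantumOp_resetFst (O := Fin (S.oB i)) (M := Fin (S.bob.mem i)) y₀)
  rw [← traceOutA_applyB] at key
  have h1 := traceOutA_applyOracle_sendLeft (A' := Fin (S.alice.mem i))
    (B' := Fin (S.bob.mem i)) e y₀ (applyB (S.bob.op i) (applyA (S.alice.op i) (S.state ρ i)))
  rw [← hO] at h1
  exact h1 ▸ key

/-! ### The contradiction between privacy and correctness -/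

namespace Protocol

variable {n : ℕ}

/-- After a correct protocol for the swap, Alice's register is correlated with the reference qubit
of Bob's input. -/
theorem IsCorrect.not_isDecoupled {P : Protocol n 2 2} {δ c : ℝ} (h : P.IsCorrect swapGate δ)
    (hP : (P.state maxEntangled n).PosSemidef) (hδ : 2 * δ + c < 1 / 4) :
    ¬ IsDecoupled (Equiv.refl _) c (traceOutB (P.state maxEntangled n)) := by
  rintro ⟨ν, -, hν⟩
  have hU : (applyU swapGate.1 maxEntangled).PosSemidef :=
    isState_maxEntangled.1.mul_mul_conjTranspose_same _
  have hout := (HermBound.of_traceDist_le (hP.submatrix _) hU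
    (h _ isState_maxEntangled)).map traceOutB
    (fun A B => by ext; simp [traceOutB, Finset.sum_sub_distrib])
    (fun _ => traceOutB_posSemidef) traceOutB_trace
  -- A matrix entry off-diagonal in R_B: it vanishes for a decoupled operator and equals 1/4 for the
  -- ideal output.
  have h1 := hν.norm_entry_le (P.outA.symm 0, (0, 0)) (P.outA.symm 1, (0, 1))
  have h2 := hout.norm_entry_le (0, (0, 0)) (1, (0, 1))
  have h3 : tensorOne (Equiv.refl _) ν (P.outA.symm 0, (0, 0)) (P.outA.symm 1, (0, 1)) = 0 := by
    simp [tensorOne]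
  have h4 : traceOutB (applyU swapGate.1 maxEntangled) (0, (0, 0)) (1, (0, 1)) = 1 / 4 := by
    rw [traceOutB_applyU_maxEntangled]
    simp [tensorOne, bellHalf]
    norm_num
  have h5 : traceOutB (P.output maxEntangled) (0, (0, 0)) (1, (0, 1)) =
      traceOutB (P.state maxEntangled n) (P.outA.symm 0, (0, 0)) (P.outA.symm 1, (0, 1)) :=
    P.outB.symm.sum_comp fun b => P.state maxEntangled n
      ((P.outA.symm 0, b), (0, 0)) ((P.outA.symm 1, b), (0, 1))
  rw [Matrix.sub_apply, h3, sub_zero] at h1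
  have h7 : ‖traceOutB (P.output maxEntangled) (0, (0, 0)) (1, (0, 1)) - 1 / 4‖ ≤ 2 * δ := by
    rw [← h4]
    refine le_trans (le_of_eq ?_) h2
    congr 1
    simp only [traceOutB, Matrix.of_apply, Matrix.sub_apply, Finset.sum_sub_distrib]
    rfl
  rw [h5] at h7
  have h8 := norm_sub_norm_le (1 / 4 : ℂ)
    (traceOutB (P.state maxEntangled n) (P.outA.symm 0, (0, 0)) (P.outA.symm 1, (0, 1)))
  rw [norm_sub_rev] at h8
  norm_num at h8 h7
  linarith

/-- The bound 1/20 serves both contradictions: monogamy needs 8δ < 1, the comparison of entries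
needs 4δ < 1/4. -/
theorem IsCorrect.not_isPrivate {P : Protocol n 2 2} (hP : P.IsBare) {δ ε : ℝ}
    (hδ₀ : 0 ≤ δ) (hδ : δ ≤ 1 / 20) (hε : 0 ≤ ε) (hc : P.IsCorrect swapGate δ) :
    ¬ P.IsPrivate swapGate δ ε := by
  rintro ⟨hpA, hpB⟩
  obtain ⟨A', B', T, U, hT, hU, h⟩ := hP.exists_purification
  set S := (P.toStrategy.withAlice A').withBob B'
  set ρ := maxEntangled
  let VA : ∀ i, Op (A'.Space i × Ref 2 2) := fun i => traceOutB (S.state ρ i)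
  let VB : ∀ i, Op (B'.Space i × Ref 2 2) := fun i => traceOutA (S.state ρ i)
  have hpure : ∀ i ≤ n, IsPure (S.state ρ i) := fun i hi =>
    (h _ ρ i hi).2.2.2.2 isPure_maxEntangled
  -- Alice's view against honest Bob equals her view against purified Bob, since Bob's environment
  -- is traced out in either case.
  have hVA : ∀ i ≤ n, traceOutB ((P.withAlice A').state ρ i) = VA i := by
    intro i hi
    rw [← (h _ ρ i hi).2.2.2.1]
    exact traceOutB_applyB (hU i).2 _
  have hVB : ∀ i ≤ n, traceOutA ((P.withBob B').state ρ i) = VB i := by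
    intro i hi
    rw [← (h _ ρ i hi).2.2.1]
    exact traceOutA_applyA (hT i).2 _
  have hspA : P.IsSpeciousA ε A' := by
    refine ⟨T, fun i _ _ => hT i, fun σ _ i _ hi =>
      traceDist_le_of_eq (h _ σ i hi).1 hε⟩
  have hspB : P.IsSpeciousB ε B' := by
    refine ⟨U, fun i _ _ => hU i, fun σ _ i _ hi =>
      traceDist_le_of_eq (h _ σ i hi).2.1 hε⟩
  obtain ⟨Φ, q, hΦ, hq⟩ := hpA A' hspA
  obtain ⟨Φ', q', hΦ', hq'⟩ := hpB B' hspB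
  have hρ0 := isState_maxEntangled.1
  have hρU : (applyU swapGate.1 maxEntangled).PosSemidef :=
    hρ0.mul_mul_conjTranspose_same _
  -- `Equiv.refl` stands for decoupling from R_B and `Equiv.prodComm` for R_A. Privacy says nothing
  -- at time 0, where the input itself is decoupled from R_B.
  have hA : ∀ i ≤ n, IsDecoupled (Equiv.refl _) (2 * δ) (VA i) ∨
      (1 ≤ i ∧ IsDecoupled (Equiv.prodComm _ _) (2 * δ) (VA i)) := by
    intro i hi
    have hV := traceOutB_posSemidef (hpure i hi).posSemidef
    rcases Nat.eq_zero_or_pos i with rfl | h0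
    · left
      refine isDecoupled_of_traceDist_le isQuantumOp_id (traceOutB_posSemidef hρ0)
        traceOutB_maxEntangled hV (traceDist_le_of_eq rfl hδ₀) rfl rfl
    · have hd := hq ρ isState_maxEntangled i h0 hi
      cases hqi : q i
      · rw [hqi] at hd
        exact Or.inl (isDecoupled_of_traceDist_le (hΦ i h0 hi) (traceOutB_posSemidef hρ0)
          traceOutB_maxEntangled hV hd (traceOutB_applyA _ _) (hVA i hi))
      · rw [hqi] at hd
        exact Or.inr ⟨h0, isDecoupled_of_traceDist_le (hΦ i h0 hi) (traceOutB_posSemidef hρU)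
          traceOutB_applyU_maxEntangled hV hd (traceOutB_applyA _ _) (hVA i hi)⟩
  have hB : ∀ i ≤ n, IsDecoupled (Equiv.prodComm _ _) (2 * δ) (VB i) ∨
      IsDecoupled (Equiv.refl _) (2 * δ) (VB i) := by
    intro i hi
    have hV := traceOutA_posSemidef (hpure i hi).posSemidef
    rcases Nat.eq_zero_or_pos i with rfl | h0
    · left
      refine isDecoupled_of_traceDist_le isQuantumOp_id (traceOutA_posSemidef hρ0)
        traceOutA_maxEntangled hV (traceDist_le_of_eq rfl hδ₀) rfl rfl
    · have hd := hq' ρ isState_maxEntangled i h0 hi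
      cases hqi : q' i
      · rw [hqi] at hd
        exact Or.inl (isDecoupled_of_traceDist_le (hΦ' i h0 hi) (traceOutA_posSemidef hρ0)
          traceOutA_maxEntangled hV hd (traceOutA_applyB _ _) (hVB i hi))
      · rw [hqi] at hd
        exact Or.inr (isDecoupled_of_traceDist_le (hΦ' i h0 hi) (traceOutA_posSemidef hρU)
          traceOutA_applyU_maxEntangled hV hd (traceOutA_applyB _ _) (hVB i hi))
  have hmono : ∀ i ≤ n, ∀ f : Ref 2 2 ≃ Fin 2 × Fin 2, IsDecoupled f (2 * δ) (VA i) →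
      ¬ IsDecoupled f (2 * δ) (VB i) := by
    intro i hi f h1 h2
    have := (hpure i hi).one_le_of_isDecoupled h1 h2
    linarith
  have hall : ∀ i ≤ n, IsDecoupled (Equiv.refl _) (2 * δ) (VA i) := by
    intro i
    induction i with
    | zero => exact fun hi => (hA 0 hi).resolve_right fun h => by omega
    | succ i ih =>
      intro hi
      have h1 := ih (Nat.le_of_succ_le hi)
      refine (hA (i + 1) hi).elim id fun h2 => ?_
      rcases hP i hi with ⟨e, x₀, hO⟩ | ⟨e, y₀, hO⟩
      · exact S.isDecoupled_traceOutB_succ hi h1 hO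
      -- Bob sends: by monogamy at time `i` he is decoupled from R_A, he remains so, and monogamy at
      -- time `i + 1` excludes R_A for Alice.
      · have h3 := (hB i (Nat.le_of_succ_le hi)).resolve_right
          (hmono i (Nat.le_of_succ_le hi) _ h1)
        exact absurd (S.isDecoupled_traceOutA_succ hi h3 hO) (hmono (i + 1) hi _ h2.2)
  have hn : traceOutB (P.state ρ n) = tensorId (Ref 2 2) (T n) (VA n) :=
    (congrArg traceOutB (h _ ρ n le_rfl).1.symm).trans
      ((traceOutB_applyA _ _).trans (congrArg (tensorId (Ref 2 2) (T n)) (hVA n le_rfl)))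
  -- Correctness concerns the honest run, whose Alice view is a local operation on the purified one,
  -- hence still decoupled from R_B.
  refine hc.not_isDecoupled ?_ (by linarith : 2 * δ + 2 * δ < 1 / 4)
    (hn ▸ (hall n le_rfl).tensorId (hT n))
  have h1 : ((P.withAlice A').state ρ n).PosSemidef :=
    (h _ ρ n le_rfl).2.2.2.1 ▸ (hU n).applyB_posSemidef (hpure n le_rfl).posSemidef
  exact (h _ ρ n le_rfl).1 ▸ (hT n).applyA_posSemidef h1

theorem IsCorrect.mono {P : Protocol n 2 2} {V : Matrix.unitaryGroup (Fin 2 × Fin 2) ℂ}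
    {δ δ' : ℝ} (h : P.IsCorrect V δ) (hδ : δ ≤ δ') : P.IsCorrect V δ' :=
  fun ρ hρ => (h ρ hρ).trans hδ

theorem IsPrivate.mono {P : Protocol n 2 2} {V : Matrix.unitaryGroup (Fin 2 × Fin 2) ℂ}
    {δ δ' ε : ℝ} (h : P.IsPrivate V δ ε) (hδ : δ ≤ δ') : P.IsPrivate V δ' ε := by
  refine ⟨fun A' hA' => ?_, fun B' hB' => ?_⟩
  · obtain ⟨Φ, q, hΦ, hq⟩ := h.1 A' hA'
    exact ⟨Φ, q, hΦ, fun ρ hρ i hi hn => (hq ρ hρ i hi hn).trans hδ⟩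
  · obtain ⟨Φ, q, hΦ, hq⟩ := h.2 B' hB'
    exact ⟨Φ, q, hΦ, fun ρ hρ i hi hn => (hq ρ hρ i hi hn).trans hδ⟩

end Protocol

end TwoParty

end

theorem theorem1 :
    (∃ ε₀ : ℝ, 0 < ε₀ ∧
      ∀ (n : ℕ) (P : TwoParty.Protocol n 2 2), P.IsBare → ∀ ε : ℝ, 0 ≤ ε →
        ¬ (P.IsCorrect TwoParty.swapGate ε₀ ∧ P.IsPrivate TwoParty.swapGate ε₀ ε)) ∧
    (∀ (n : ℕ → ℕ) (P : ∀ m, TwoParty.Protocol (n m) 2 2), (∀ m, (P m).IsBare) →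
      ∀ ε : ℕ → ℝ, (∀ m, 0 ≤ ε m) →
        ¬ ((∃ μ : ℕ → ℝ, Filter.Tendsto μ Filter.atTop (nhds 0) ∧
              ∀ m, 1 ≤ m → (P m).IsCorrect TwoParty.swapGate (μ m)) ∧
            TwoParty.StatisticallyPrivate P TwoParty.swapGate ε)) := by
  have key : ∀ (n : ℕ) (P : TwoParty.Protocol n 2 2), P.IsBare → ∀ ε : ℝ, 0 ≤ ε →
      ¬ (P.IsCorrect TwoParty.swapGate (1 / 20) ∧ P.IsPrivate TwoParty.swapGate (1 / 20) ε) :=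
    fun n P hP ε hε h => h.1.not_isPrivate hP (by norm_num) le_rfl hε h.2
  refine ⟨⟨1 / 20, by norm_num, key⟩, ?_⟩
  rintro n P hP ε hε ⟨⟨μ, hμ, hc⟩, γ, hγ, hpriv⟩
  have hexp : Filter.Tendsto (fun m : ℕ => (2 : ℝ) ^ (-γ * (m : ℝ))) Filter.atTop (nhds 0) := by
    have h1 : (fun m : ℕ => (2 : ℝ) ^ (-γ * (m : ℝ))) = fun m : ℕ => ((2 : ℝ) ^ (-γ)) ^ m := by
      funext m
      rw [Real.rpow_mul (by norm_num), Real.rpow_natCast]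
    rw [h1]
    exact tendsto_pow_atTop_nhds_zero_of_lt_one (by positivity)
      (Real.rpow_lt_one_of_one_lt_of_neg (by norm_num) (by linarith))
  -- Both errors tend to 0, so a single large `m ≥ 1` already violates the first part.
  have hev := ((hμ.eventually (gt_mem_nhds (by norm_num : (0 : ℝ) < 1 / 20))).and
    (hexp.eventually (gt_mem_nhds (by norm_num : (0 : ℝ) < 1 / 20)))).and
    (Filter.eventually_ge_atTop 1)
  obtain ⟨m, ⟨h1, h2⟩, hm⟩ := hev.exists
  exact key _ (P m) (hP m) (ε m) (hε m) ⟨(hc m hm).mono h1.le, (hpriv m hm).mono h2.le⟩
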